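/- Let $k$ be a field of characteristic different from $2$ and $3$ that contains a primitive cube root of unity, let $S\in k[t]$ be a polynomial of degree $6$ without repeated roots in an algebraic closure of $k$, let $C$ be the smooth projective curve of genus $2$ over $k$ with affine equation $u^2=S(t)$, and let $J(C)$ be the group of classes of degree-zero divisors on $C$ (over $k$) modulo principal divisors. Call $y\in k[t]$ minimal if $\deg y\le 3$ and $y^2-S=\alpha x^3$ for some $\alpha\in k^*$ and $x\in k[t]$. (1) If $y\in k[t]$ is minimal, then the rational function $y(t)-u$ on $C$ has divisor $3D$ for some divisor $D$ of degree $0$ on $C$ that is not principal (so $[D]$ is a nonzero $3$-torsion element of $J(C)$). (2) For each nonzero $T\in J(C)$ with $3T=0$ there is exactly one minimal $y\in k[t]$ such that the divisor of $y(t)-u$ is $3D$ for a divisor $D$ of degree $0$ on $C$ with class $[D]=T$. -/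

import Mathlib

open Polynomial

noncomputable section

/-! ### Divisors and divisor classes of a function field -/

/-- A point of the complete regular curve with function field `K` over `k`: a discrete valuation
ring of `K` that contains `k` and has fraction field `K`. -/
structure CurvePoint (k K : Type*) [Field k] [Field K] [Algebra k K] where
  /-- the local ring of the point -/
  ring : ValuationSubring K
  const_mem : ∀ c : k, algebraMap k K c ∈ ring
  dvr : IsDiscreteValuationRing ring

namespace CurvePoint

variable {k K : Type*} [Field k] [Field K] [Algebra k K]

instance (P : CurvePoint k K) : IsDiscreteValuationRing P.ring := P.dvr

instance (P : CurvePoint k K) : Algebra k P.ring :=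
  ((algebraMap k K).codRestrict P.ring.toSubring P.const_mem).toAlgebra

/-- The degree of a point: the degree over `k` of its residue field. -/
def degree (P : CurvePoint k K) : ℕ :=
  Module.finrank k (IsLocalRing.ResidueField P.ring)

/-- The order of vanishing of the rational function `f` at `P`, negative at a pole
(the value at `f = 0` is `0` by convention and is never used). -/
def ord (P : CurvePoint k K) (f : K) : ℤ :=
  -WithZero.log ((IsDiscreteValuationRing.maximalIdeal P.ring).valuation K f)

theorem ord_one (P : CurvePoint k K) : P.ord 1 = 0 := by
  simp [ord]

theorem ord_mul (P : CurvePoint k K) {f g : K} (hf : f ≠ 0) (hg : g ≠ 0) :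
    P.ord (f * g) = P.ord f + P.ord g := by
  have h1 : (IsDiscreteValuationRing.maximalIdeal P.ring).valuation K f ≠ 0 := by simpa using hf
  have h2 : (IsDiscreteValuationRing.maximalIdeal P.ring).valuation K g ≠ 0 := by simpa using hg
  simp only [ord, map_mul, WithZero.log_mul h1 h2]
  ring

theorem ord_inv (P : CurvePoint k K) (f : K) : P.ord f⁻¹ = -P.ord f := by
  simp [ord]

end CurvePoint

/-- The group of divisors. -/
abbrev CurveDivisor (k K : Type*) [Field k] [Field K] [Algebra k K] : Type _ :=
  CurvePoint k K →₀ ℤ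

namespace CurveDivisor

variable {k K : Type*} [Field k] [Field K] [Algebra k K]

/-- `D` is the divisor of the nonzero rational function `f`. -/
def IsDivisorOf (D : CurveDivisor k K) (f : K) : Prop :=
  f ≠ 0 ∧ ∀ P : CurvePoint k K, D P = P.ord f

variable (k K)

/-- The degree homomorphism `∑ n_P P ↦ ∑ n_P deg P`. -/
def deg : CurveDivisor k K →+ ℤ :=
  Finsupp.liftAddHom fun P => AddMonoidHom.mulRight (P.degree : ℤ)

/-- The group of principal divisors. -/
def principal : AddSubgroup (CurveDivisor k K) where
  carrier := {D | ∃ f : K, D.IsDivisorOf f}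
  zero_mem' := ⟨1, one_ne_zero, fun P => by simp [P.ord_one]⟩
  add_mem' := by
    rintro D E ⟨f, hf, hD⟩ ⟨g, hg, hE⟩
    exact ⟨f * g, mul_ne_zero hf hg, fun P => by simp [hD P, hE P, P.ord_mul hf hg]⟩
  neg_mem' := by
    rintro D ⟨f, hf, hD⟩
    exact ⟨f⁻¹, inv_ne_zero hf, fun P => by simp [hD P, P.ord_inv]⟩

/-- The group of divisors of degree `0`. -/
abbrev degZero : AddSubgroup (CurveDivisor k K) := (deg k K).ker

/-- The group of divisor classes of degree `0`: divisors of degree `0` modulo the principal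
divisors. -/
abbrev ClassGroupZero : Type _ :=
  degZero k K ⧸ (principal k K).addSubgroupOf (degZero k K)

end CurveDivisor

/-! ### The genus 2 curve `u² = S(t)` -/

/-- A polynomial of degree `6` without repeated roots (in an algebraic closure). -/
structure SeparableSextic (k : Type*) [Field k] where
  poly : k[X]
  natDegree_eq : poly.natDegree = 6
  separable : poly.Separable

namespace SeparableSextic

variable {k : Type*} [Field k] (S : SeparableSextic k)

/-- The ring `k[t, u] / (u² - S(t))`. -/
abbrev CoordinateRing : Type _ := AdjoinRoot (X ^ 2 - C S.poly : k[X][X])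

theorem prime_equation : Prime (X ^ 2 - C S.poly : k[X][X]) := by
  refine Irreducible.prime ?_
  have hm : (X ^ 2 - C S.poly : k[X][X]).Monic := monic_X_pow_sub_C _ two_ne_zero
  have hd : (X ^ 2 - C S.poly : k[X][X]).natDegree = 2 := natDegree_X_pow_sub_C
  rw [hm.irreducible_iff_roots_eq_zero_of_degree_le_three hd.ge (by rw [hd]; norm_num)]
  refine Multiset.eq_zero_of_forall_notMem fun q hq => ?_
  have hroot : q ^ 2 = S.poly := by
    have := (mem_roots hm.ne_zero).1 hq
    simpa [IsRoot, sub_eq_zero] using this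
  have hu : IsUnit q := S.separable.squarefree q ⟨1, by rw [← hroot]; ring⟩
  have h6 := S.natDegree_eq
  rw [← hroot, natDegree_pow, natDegree_eq_zero_of_isUnit hu] at h6
  omega

instance : IsDomain S.CoordinateRing := AdjoinRoot.isDomain_of_prime S.prime_equation

/-- The function field of the curve `C : u² = S(t)`. -/
abbrev FunctionField : Type _ := FractionRing S.CoordinateRing

/-- A polynomial `y(t)` as a rational function on `C`. -/
def ofPoly (y : k[X]) : S.FunctionField :=
  algebraMap S.CoordinateRing S.FunctionField (AdjoinRoot.of _ y)

/-- The rational function `u` on `C`. -/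
def u : S.FunctionField :=
  algebraMap S.CoordinateRing S.FunctionField (AdjoinRoot.root _)

/-- The group of divisors on (the complete regular model of) `C`. -/
abbrev Divisor : Type _ := CurveDivisor k S.FunctionField

/-- The group `J(C)` of divisor classes of degree `0` on `C`. -/
abbrev Jacobian : Type _ := CurveDivisor.ClassGroupZero k S.FunctionField

/-- `y` has degree at most `3`, and `y² - S` is a nonzero constant times a cube in `k[t]`. -/
def IsMinimal (y : k[X]) : Prop :=
  y.natDegree ≤ 3 ∧ ∃ (α : k) (x : k[X]), α ≠ 0 ∧ y ^ 2 - S.poly = C α * x ^ 3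

end SeparableSextic

end

/-! Let `Z` be the divisor of poles of `t`; it has degree 2, and `u` has pole divisor `3Z`. Three
facts carry the proof. (a) A function with poles at most `nZ` is `a(t) + b(t) u` with `deg a ≤ n`
and, if `b ≠ 0`, `deg b + 3 ≤ n` (`exists_eq_of_neg_poles_le`); so for `n ≤ 2` it is a polynomial in
`t`, and for `n = 3` the coefficient `b` is constant. (b) A divisor of degree at least 2 has a
nonzero section (`exists_neg_le_ord`), and principal divisors have degree 0. (c) A polynomial in `t`
whose order at every point with `t` finite is a multiple of 3 is a constant times a cube
(`exists_eq_C_mul_cube`), because ramification over the `t`-line is at most 2.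

Minimal to torsion: in `(y - u)(y + u) = αx³` the two factors have no common zero where `t` is
finite, since `S` is squarefree; so every order of `y - u` is a multiple of 3, and its divisor is
`3D`. If `D = div g`, then `g` has poles at most `Z`, so `g` is a polynomial in `t`, and `y - u = c
g³` contradicts the independence of `1` and `u` over `k[t]`.

Torsion to minimal: let `3D₀ = div f` and choose a section `g` of `D₀ + Z`, which has degree 2. Then
`f g³` has divisor `3(D₀ + div g) ≥ -3Z`, so it equals `a(t) + βu`. If `β = 0`, then `a` is a
constant times a cube and `D₀` is principal. Otherwise rescaling gives `y - u`, and its norm `y² -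
S` is a constant times a cube by (c).

Uniqueness: if `y₁ - u = c g³ (y₂ - u)` and `y₂² - S = αx³`, then `gx` has poles at most `2Z`, so it
is a polynomial `a(t)`. Comparing the coefficients of `u` in `x³(y₁ - u) = c a³ (y₂ - u)` gives `x³
= c a³`, hence `y₁ = y₂`. -/

open Polynomial

noncomputable section

set_option linter.unusedSectionVars false

/-! ### Orders of functions at a point -/

namespace CurvePoint

variable {k K : Type*} [Field k] [Field K] [Algebra k K] (P : CurvePoint k K)

theorem ord_zero : P.ord 0 = 0 := by
  simp [ord]

theorem ord_nonneg_iff {f : K} (hf : f ≠ 0) : 0 ≤ P.ord f ↔ f ∈ P.ring := by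
  have h1 : (IsDiscreteValuationRing.maximalIdeal P.ring).valuation K f ≠ 0 := by simpa using hf
  rw [ord, neg_nonneg, ← WithZero.log_one, WithZero.log_le_log h1 one_ne_zero]
  constructor
  · intro h
    obtain ⟨a, rfl⟩ := IsDiscreteValuationRing.exists_lift_of_le_one h
    exact a.2
  · intro h
    exact (IsDiscreteValuationRing.maximalIdeal P.ring).valuation_le_one ⟨f, h⟩

theorem exists_ord_eq_one : ∃ f : K, f ≠ 0 ∧ P.ord f = 1 := by
  obtain ⟨f, hf⟩ := (IsDiscreteValuationRing.maximalIdeal P.ring).valuation_exists_uniformizer K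
  refine ⟨f, ?_, by simp [ord, hf]⟩
  rintro rfl
  rw [map_zero] at hf
  exact WithZero.exp_ne_zero hf.symm

theorem ord_neg (f : K) : P.ord (-f) = P.ord f := by
  simp [ord]

theorem ord_pow (f : K) (n : ℕ) : P.ord (f ^ n) = n * P.ord f := by
  simp [ord]

theorem ord_zpow (f : K) (n : ℤ) : P.ord (f ^ n) = n * P.ord f := by
  simp [ord]

theorem ord_div {f g : K} (hf : f ≠ 0) (hg : g ≠ 0) : P.ord (f / g) = P.ord f - P.ord g := by
  rw [div_eq_mul_inv, P.ord_mul hf (inv_ne_zero hg), ord_inv, sub_eq_add_neg]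

theorem ord_algebraMap (c : k) : P.ord (algebraMap k K c) = 0 := by
  rcases eq_or_ne c 0 with rfl | hc
  · simp [ord_zero]
  have hc' : algebraMap k K c ≠ 0 := by simpa using hc
  have h1 := (P.ord_nonneg_iff hc').2 (P.const_mem c)
  have h2 := (P.ord_nonneg_iff (inv_ne_zero hc')).2 (by rw [← map_inv₀]; exact P.const_mem _)
  rw [ord_inv] at h2
  omega

/-- The ultrametric inequality. Since `ord 0 = 0` by convention instead of `∞`, the bounds are
required of nonzero summands only. -/
theorem le_ord_add {f g : K} {n : ℤ} (hfg : f + g ≠ 0) (hf : f ≠ 0 → n ≤ P.ord f)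
    (hg : g ≠ 0 → n ≤ P.ord g) : n ≤ P.ord (f + g) := by
  rcases eq_or_ne f 0 with rfl | hf0
  · rw [zero_add] at hfg ⊢
    exact hg hfg
  rcases eq_or_ne g 0 with rfl | hg0
  · rw [add_zero]
    exact hf hf0
  set v := (IsDiscreteValuationRing.maximalIdeal P.ring).valuation K with hv
  have h1 : v f ≠ 0 := by simpa [hv] using hf0
  have h2 : v g ≠ 0 := by simpa [hv] using hg0
  have h3 : v (f + g) ≠ 0 := by rw [Valuation.ne_zero_iff]; exact hfg
  have hf := hf hf0
  have hg := hg hg0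
  simp only [ord, ← hv] at *
  have hm := v.map_add f g
  rcases le_max_iff.1 hm with h | h
  · rw [← WithZero.log_le_log h3 h1] at h
    omega
  · rw [← WithZero.log_le_log h3 h2] at h
    omega

theorem le_ord_sub {f g : K} {n : ℤ} (hfg : f - g ≠ 0) (hf : f ≠ 0 → n ≤ P.ord f)
    (hg : g ≠ 0 → n ≤ P.ord g) : n ≤ P.ord (f - g) := by
  rw [sub_eq_add_neg] at hfg ⊢
  exact P.le_ord_add hfg hf (fun h => by rw [ord_neg]; exact hg (neg_ne_zero.1 h))

theorem ord_add_eq_left {f g : K} (hf : f ≠ 0) (h : g ≠ 0 → P.ord f < P.ord g) :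
    f + g ≠ 0 ∧ P.ord (f + g) = P.ord f := by
  rcases eq_or_ne g 0 with rfl | hg
  · simpa using hf
  have h := h hg
  have hfg : f + g ≠ 0 := by
    intro h0
    rw [eq_neg_of_add_eq_zero_left h0, ord_neg] at h
    exact lt_irrefl _ h
  refine ⟨hfg, le_antisymm ?_ (P.le_ord_add hfg (fun _ => le_rfl) fun _ => h.le)⟩
  by_contra hlt
  have h2 := P.le_ord_sub (f := f + g) (g := g) (n := P.ord f + 1) (by simpa using hf)
    (fun _ => by omega) (fun _ => by omega)
  rw [add_sub_cancel_right] at h2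
  omega

theorem exists_eq_zpow_mul {ϖ f : K} (hϖ : ϖ ≠ 0) (h1 : P.ord ϖ = 1) (hf : f ≠ 0) :
    ∃ w : K, w ≠ 0 ∧ P.ord w = 0 ∧ f = ϖ ^ P.ord f * w := by
  have hz : ϖ ^ P.ord f ≠ 0 := zpow_ne_zero _ hϖ
  refine ⟨f / ϖ ^ P.ord f, div_ne_zero hf hz, ?_, ?_⟩
  · rw [P.ord_div hf hz, ord_zpow, h1]
    ring
  · field_simp

/-- The order function is the only normalized discrete valuation nonnegative on the local ring. -/
theorem eq_ord_of_nonneg (w : K → ℤ) (hmul : ∀ f g, f ≠ 0 → g ≠ 0 → w (f * g) = w f + w g)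
    (hw : ∀ f, f ≠ 0 → f ∈ P.ring → 0 ≤ w f) (h1 : ∃ f, f ≠ 0 ∧ w f = 1) {f : K} (hf : f ≠ 0) :
    w f = P.ord f := by
  have hone : w 1 = 0 := by
    have := hmul 1 1 one_ne_zero one_ne_zero
    simpa using this
  have hinv : ∀ f, f ≠ 0 → w f⁻¹ = - w f := fun f hf => by
    have := hmul f f⁻¹ hf (inv_ne_zero hf)
    rw [mul_inv_cancel₀ hf, hone] at this
    omega
  have hpow : ∀ f, f ≠ 0 → ∀ n : ℕ, w (f ^ n) = n * w f := fun f hf n => by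
    induction n with
    | zero => simp [hone]
    | succ n ih =>
      rw [pow_succ, hmul _ _ (pow_ne_zero _ hf) hf, ih]
      push_cast
      ring
  have hzpow : ∀ f, f ≠ 0 → ∀ n : ℤ, w (f ^ n) = n * w f := fun f hf n => by
    obtain ⟨m, rfl | rfl⟩ := n.eq_nat_or_neg
    · simpa using hpow f hf m
    · rw [zpow_neg, zpow_natCast, hinv _ (pow_ne_zero _ hf), hpow f hf]
      ring
  have hunit : ∀ f, f ≠ 0 → P.ord f = 0 → w f = 0 := fun f hf h0 => by
    have h1 := hw f hf ((P.ord_nonneg_iff hf).1 h0.ge)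
    have h2 := hw f⁻¹ (inv_ne_zero hf)
      ((P.ord_nonneg_iff (inv_ne_zero hf)).1 (by rw [ord_inv, h0, neg_zero]))
    rw [hinv f hf] at h2
    omega
  obtain ⟨ϖ, hϖ, hϖ1⟩ := P.exists_ord_eq_one
  -- `w` vanishes on units, so it is determined by its value at a uniformizer; that value is
  -- nonnegative and divides 1.
  have key : ∀ f, f ≠ 0 → w f = P.ord f * w ϖ := fun f hf => by
    obtain ⟨g, hg, hg0, h⟩ := P.exists_eq_zpow_mul hϖ hϖ1 hf
    conv_lhs => rw [h]
    rw [hmul _ _ (zpow_ne_zero _ hϖ) hg, hunit g hg hg0, hzpow ϖ hϖ, add_zero]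
  obtain ⟨f₁, hf₁, hf₁1⟩ := h1
  have h2 : 0 ≤ w ϖ := hw ϖ hϖ ((P.ord_nonneg_iff hϖ).1 (by omega))
  have h3 : w ϖ ∣ 1 := ⟨P.ord f₁, by rw [← hf₁1, key f₁ hf₁]; ring⟩
  rw [key f hf, Int.eq_one_of_dvd_one h2 h3, mul_one]

theorem ring_injective : Function.Injective (CurvePoint.ring : CurvePoint k K → _) := by
  rintro ⟨R, _, _⟩ ⟨R', _, _⟩ h
  cases h
  rfl

theorem mem_maximalIdeal_iff {f : K} (hf : f ∈ P.ring) (hf0 : f ≠ 0) :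
    (⟨f, hf⟩ : P.ring) ∈ IsLocalRing.maximalIdeal P.ring ↔ 0 < P.ord f := by
  rw [IsLocalRing.mem_maximalIdeal, mem_nonunits_iff, ← not_iff_not, not_not]
  have h1 := (P.ord_nonneg_iff hf0).2 hf
  constructor
  · intro h
    obtain ⟨g, hg⟩ := h.exists_right_inv
    have hg' : f * (g : K) = 1 := congrArg Subtype.val hg
    have hg0 : (g : K) ≠ 0 := right_ne_zero_of_mul_eq_one hg'
    have h2 := (P.ord_nonneg_iff hg0).2 g.2
    have h3 := P.ord_mul hf0 hg0
    rw [hg', ord_one] at h3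
    omega
  · intro h
    have h2 : f⁻¹ ∈ P.ring := (P.ord_nonneg_iff (inv_ne_zero hf0)).1 (by rw [ord_inv]; omega)
    exact IsUnit.of_mul_eq_one ⟨f⁻¹, h2⟩ (Subtype.ext (mul_inv_cancel₀ hf0))

/-- The image of a point under an automorphism of the function field. -/
def comap (σ : K ≃ₐ[k] K) : CurvePoint k K where
  ring := P.ring.comap (σ : K →+* K)
  const_mem c := by
    rw [ValuationSubring.mem_comap]
    simpa using P.const_mem c
  dvr := by
    let e : P.ring.comap (σ : K →+* K) ≃+* P.ring :=
      { toFun := fun x => ⟨σ x, x.2⟩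
        invFun := fun x => ⟨σ.symm x, by
          rw [ValuationSubring.mem_comap]
          simp⟩
        left_inv := fun x => by simp
        right_inv := fun x => by simp
        map_mul' := fun x y => by ext; simp
        map_add' := fun x y => by ext; simp }
    exact IsDiscreteValuationRing.RingEquivClass.isDiscreteValuationRing e.symm

theorem ord_comap (σ : K ≃ₐ[k] K) (f : K) : (P.comap σ).ord f = P.ord (σ f) := by
  rcases eq_or_ne f 0 with rfl | hf
  · simp [ord_zero]
  refine ((P.comap σ).eq_ord_of_nonneg (fun f => P.ord (σ f)) ?_ ?_ ?_ hf).symm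
  · intro f g hf hg
    simp only [map_mul]
    exact P.ord_mul (by simpa) (by simpa)
  · intro f hf h
    exact (P.ord_nonneg_iff (by simpa)).2 h
  · obtain ⟨f, hf, h⟩ := P.exists_ord_eq_one
    exact ⟨σ.symm f, by simpa, by simpa⟩

end CurvePoint

/-! ### Points given by maximal ideals of a Dedekind domain -/

namespace CurvePoint

open IsDedekindDomain Module

section DedekindModel

variable {k K : Type*} [Field k] [Field K] [Algebra k K]
variable {B : Type*} [CommRing B] [IsDedekindDomain B] [Algebra k B] [Algebra B K]
  [IsScalarTower k B K] [IsFractionRing B K]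

variable (k K) in
/-- The point defined by a maximal ideal of a Dedekind domain with fraction field `K`. -/
def ofHeightOne (v : HeightOneSpectrum B) : CurvePoint k K where
  ring := (v.valuation K).valuationSubring
  const_mem c := by
    rw [Valuation.mem_valuationSubring_iff, IsScalarTower.algebraMap_apply k B K]
    exact v.valuation_le_one _
  dvr := (v.valuation K).valuationSubring_isDiscreteValuationRing

/-- `ord` is defined by the maximal ideal of the local ring, not by `v`; uniqueness of the
normalized valuation identifies the two. -/
theorem ord_ofHeightOne (v : HeightOneSpectrum B) {f : K} (hf : f ≠ 0) :
    (ofHeightOne k K v).ord f = -WithZero.log (v.valuation K f) := by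
  refine ((ofHeightOne k K v).eq_ord_of_nonneg (fun f => -WithZero.log (v.valuation K f))
    ?_ ?_ ?_ hf).symm
  · intro f g hf hg
    rw [map_mul, WithZero.log_mul (by simpa using hf) (by simpa using hg)]
    ring
  · intro f hf h
    have h1 : v.valuation K f ≠ 0 := by simpa using hf
    rw [neg_nonneg, ← WithZero.log_one, WithZero.log_le_log h1 one_ne_zero]
    exact h
  · obtain ⟨f, hf⟩ := v.valuation_exists_uniformizer K
    refine ⟨f, ?_, by simp [hf]⟩
    rintro rfl
    rw [map_zero] at hf
    exact WithZero.exp_ne_zero hf.symm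

theorem ord_ofHeightOne_pos_iff (v : HeightOneSpectrum B) {b : B} (hb : b ≠ 0) :
    0 < (ofHeightOne k K v).ord (algebraMap B K b) ↔ b ∈ v.asIdeal := by
  have hb' : algebraMap B K b ≠ 0 := by simpa using hb
  have h1 : v.valuation K (algebraMap B K b) ≠ 0 := by simpa using hb
  rw [ord_ofHeightOne v hb', neg_pos, ← WithZero.log_one, WithZero.log_lt_log h1 one_ne_zero,
    v.valuation_lt_one_iff_mem]

variable (k K) in
theorem ofHeightOne_injective :
    Function.Injective (ofHeightOne k K : HeightOneSpectrum B → CurvePoint k K) := by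
  intro v w h
  ext b
  rcases eq_or_ne b 0 with rfl | hb
  · simp
  rw [← ord_ofHeightOne_pos_iff (k := k) (K := K) v hb, h, ord_ofHeightOne_pos_iff w hb]

/-- The maximal ideal of `P` contracts to a prime `Q` of `B`. It is nonzero, otherwise no function
would have positive order. The valuation ring of `Q` lies in that of `P`, and a discrete valuation
ring has no larger proper subring of `K` above it, so they agree. -/
theorem exists_ofHeightOne_eq (P : CurvePoint k K) (hP : ∀ b : B, algebraMap B K b ∈ P.ring) :
    ∃ v : HeightOneSpectrum B, ofHeightOne k K v = P := by
  let φ : B →+* P.ring := (algebraMap B K).codRestrict P.ring.toSubring hP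
  let Q : Ideal B := (IsLocalRing.maximalIdeal P.ring).comap φ
  have hQ : ∀ b : B, b ≠ 0 → (b ∈ Q ↔ 0 < P.ord (algebraMap B K b)) := fun b hb =>
    P.mem_maximalIdeal_iff (hP b) (by simpa using hb)
  have hQ0 : Q ≠ ⊥ := by
    intro h0
    obtain ⟨f, hf, hf1⟩ := P.exists_ord_eq_one
    obtain ⟨a, b, hb, rfl⟩ := IsFractionRing.div_surjective (A := B) f
    have hb0 : b ≠ 0 := nonZeroDivisors.ne_zero hb
    have ha0 : a ≠ 0 := by
      rintro rfl
      simp at hf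
    have ha' : algebraMap B K a ≠ 0 := by simpa using ha0
    have hb' : algebraMap B K b ≠ 0 := by simpa using hb0
    rw [P.ord_div ha' hb'] at hf1
    have h1 := (P.ord_nonneg_iff hb').2 (hP b)
    have : a ∈ Q := (hQ a ha0).2 (by omega)
    rw [h0] at this
    exact ha0 this
  let v : HeightOneSpectrum B := ⟨Q, Ideal.comap_isPrime φ _, hQ0⟩
  refine ⟨v, ring_injective (ValuationSubring.eq_of_le_of_ne_top _ (fun x hx => ?_) fun htop => ?_)⟩
  · rcases eq_or_ne x 0 with rfl | hx0
    · exact P.ring.zero_mem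
    obtain ⟨n, d, h⟩ := v.exists_primeCompl_mul_eq_of_integer x hx
    have hd : (d : B) ∉ Q := d.2
    have hd0 : (d : B) ≠ 0 := fun h0 => hd (by rw [h0]; exact Q.zero_mem)
    have hd' : algebraMap B K d ≠ 0 := by simpa using hd0
    have hn' : algebraMap B K n ≠ 0 := by rw [← h]; exact mul_ne_zero hx0 hd'
    have h1 := P.ord_mul hx0 hd'
    rw [h] at h1
    have h2 := (P.ord_nonneg_iff hn').2 (hP n)
    rw [hQ _ hd0] at hd
    exact (P.ord_nonneg_iff hx0).1 (by omega)
  · obtain ⟨f, hf, hf1⟩ := P.exists_ord_eq_one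
    have h1 : f⁻¹ ∈ P.ring := by rw [htop]; trivial
    have h2 := (P.ord_nonneg_iff (inv_ne_zero hf)).2 h1
    rw [ord_inv] at h2
    omega

theorem degree_ofHeightOne (v : HeightOneSpectrum B) :
    (ofHeightOne k K v).degree = finrank k (B ⧸ v.asIdeal) := by
  set P := ofHeightOne k K v with hPdef
  have hP : ∀ b : B, algebraMap B K b ∈ P.ring := fun b => v.valuation_le_one b
  let φ : B →ₐ[k] P.ring :=
    { (algebraMap B K).codRestrict P.ring.toSubring hP with
      commutes' := fun c => Subtype.ext (IsScalarTower.algebraMap_apply k B K c).symm }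
  let ψ : B →ₐ[k] IsLocalRing.ResidueField P.ring :=
    (IsScalarTower.toAlgHom k P.ring (IsLocalRing.ResidueField P.ring)).comp φ
  have hψ : ∀ b, ψ b = IsLocalRing.residue P.ring (φ b) := fun b => rfl
  have hmem : ∀ b : B, φ b ∈ IsLocalRing.maximalIdeal P.ring ↔ b ∈ v.asIdeal := by
    intro b
    rcases eq_or_ne b 0 with rfl | hb
    · simp
    rw [← ord_ofHeightOne_pos_iff (k := k) (K := K) v hb]
    exact P.mem_maximalIdeal_iff (hP b) (by simpa using hb)
  have hker : RingHom.ker ψ = v.asIdeal := by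
    ext b
    rw [RingHom.mem_ker, hψ, IsLocalRing.residue_eq_zero_iff, hmem]
  have hsurj : Function.Surjective ψ := by
    intro y
    obtain ⟨x, rfl⟩ := IsLocalRing.residue_surjective y
    obtain ⟨n, d, h⟩ := v.exists_primeCompl_mul_eq_of_integer (x : K) x.2
    have hx : x * φ d = φ n := Subtype.ext h
    have hd : (d : B) ∉ v.asIdeal := d.2
    -- An element `n / d` of the local ring has the same residue as `n e`, where `e` inverts `d`
    -- modulo `v`.
    obtain ⟨e, he⟩ := v.isMaximal.exists_inv hd
    obtain ⟨i, hi, hei⟩ := he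
    refine ⟨n * e, ?_⟩
    rw [hψ, map_mul, ← hx, ← sub_eq_zero, ← map_sub, IsLocalRing.residue_eq_zero_iff]
    have : x * φ d * φ e - x = - (x * φ i) := by
      have h1 : φ e * φ d + φ i = 1 := by rw [← map_mul, ← map_add, hei, map_one]
      linear_combination x * h1
    rw [this]
    exact neg_mem (Ideal.mul_mem_left _ _ ((hmem i).2 hi))
  rw [degree, ← hker]
  exact (Ideal.quotientKerAlgEquivOfSurjective hsurj).toLinearEquiv.finrank_eq.symm

end DedekindModel

end CurvePoint

/-! ### The fundamental identity over an irreducible polynomial -/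

namespace CurvePoint

open IsDedekindDomain Module

section FundamentalIdentity

variable {k K : Type*} [Field k] [Field K] [Algebra k K]

/-- At a pole of `z` the leading term has strictly smaller order than the rest. -/
theorem ord_aeval_of_neg (P : CurvePoint k K) {z : K} (hz : P.ord z < 0) {p : k[X]} (hp : p ≠ 0) :
    aeval z p ≠ 0 ∧ P.ord (aeval z p) = p.natDegree * P.ord z := by
  have hz0 : z ≠ 0 := by
    rintro rfl
    simp [ord_zero] at hz
  induction h : p.natDegree using Nat.strong_induction_on generalizing p with
  | _ n ih =>
    have hl : algebraMap k K p.leadingCoeff ≠ 0 := by simpa using hp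
    have hlead : P.ord (algebraMap k K p.leadingCoeff * z ^ n) = n * P.ord z := by
      rw [P.ord_mul hl (pow_ne_zero _ hz0), ord_algebraMap, ord_pow, zero_add]
    have hsum : aeval z p = algebraMap k K p.leadingCoeff * z ^ n + aeval z p.eraseLead := by
      conv_lhs => rw [← p.eraseLead_add_C_mul_X_pow]
      simp [h, add_comm]
    have hlt : aeval z p.eraseLead ≠ 0 → P.ord (algebraMap k K p.leadingCoeff * z ^ n) <
        P.ord (aeval z p.eraseLead) := by
      intro hne
      have he0 : p.eraseLead ≠ 0 := by
        intro h0
        simp [h0] at hne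
      have hdeg : p.eraseLead.natDegree < n := by
        have := p.eraseLead_natDegree_lt_or_eraseLead_eq_zero.resolve_right he0
        omega
      rw [hlead, (ih _ hdeg he0 rfl).2]
      have : (p.eraseLead.natDegree : ℤ) < n := by exact_mod_cast hdeg
      nlinarith
    have := P.ord_add_eq_left (mul_ne_zero hl (pow_ne_zero _ hz0)) hlt
    rw [hsum, ← hlead]
    exact this

theorem ord_nonneg_of_ord_aeval_pos (P : CurvePoint k K) {z : K} {p : k[X]}
    (h : 0 < P.ord (aeval z p)) : 0 ≤ P.ord z := by
  by_contra! hz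
  have hp : p ≠ 0 := by
    rintro rfl
    simp [ord_zero] at h
  rw [(P.ord_aeval_of_neg hz hp).2] at h
  nlinarith [Int.natCast_nonneg p.natDegree]

theorem mem_ring_of_ord_nonneg (P : CurvePoint k K) {f : K} (h : 0 ≤ P.ord f) : f ∈ P.ring := by
  rcases eq_or_ne f 0 with rfl | hf
  · exact P.ring.zero_mem
  · exact (P.ord_nonneg_iff hf).1 h

theorem aeval_mem_ring (P : CurvePoint k K) {z : K} (hz : 0 ≤ P.ord z) (p : k[X]) :
    aeval z p ∈ P.ring := by
  rw [aeval_eq_sum_range]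
  refine sum_mem fun i _ => ?_
  rw [Algebra.smul_def]
  exact mul_mem (P.const_mem _) (pow_mem (P.mem_ring_of_ord_nonneg hz) _)

variable [Algebra k[X] K] [IsScalarTower k k[X] K]

theorem algebraMap_eq_aeval (p : k[X]) : algebraMap k[X] K p = aeval (algebraMap k[X] K X) p := by
  rw [aeval_algebraMap_apply, aeval_X_left_apply]

theorem mem_ring_of_isIntegral (P : CurvePoint k K) (hz : 0 ≤ P.ord (algebraMap k[X] K X)) {f : K}
    (hf : IsIntegral k[X] f) : f ∈ P.ring := by
  let : Algebra k[X] P.ring := ((algebraMap k[X] K).codRestrict P.ring.toSubring fun p => by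
    rw [algebraMap_eq_aeval]
    exact P.aeval_mem_ring hz p).toAlgebra
  have : IsScalarTower k[X] P.ring K := .of_algebraMap_eq fun _ => rfl
  have hf' : IsIntegral P.ring f := hf.tower_top
  obtain ⟨y, rfl⟩ := IsIntegrallyClosed.isIntegral_iff.1 hf'
  exact y.2

variable {B : Type*} [CommRing B] [IsDedekindDomain B] [Algebra k B] [Algebra B K]
  [IsScalarTower k B K] [IsFractionRing B K] [Algebra k[X] B] [IsScalarTower k k[X] B]
  [IsScalarTower k[X] B K] [Module.Finite k[X] B] [Module.IsTorsionFree k[X] B]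

theorem ord_ofHeightOne_of_liesOver {π : k[X]} (hπ : π ≠ 0) (v : HeightOneSpectrum B)
    [v.asIdeal.LiesOver (Ideal.span {π})] :
    (ofHeightOne k K v).ord (algebraMap k[X] K π) = v.asIdeal.ramificationIdx k[X] := by
  have hinj := FaithfulSMul.algebraMap_injective k[X] B
  have h0 : algebraMap k[X] B π ≠ 0 := by rwa [Ne, map_eq_zero_iff _ hinj]
  have h0' : algebraMap B K (algebraMap k[X] B π) ≠ 0 := by simpa using h0
  have hmap : (Ideal.span {π}).map (algebraMap k[X] B) = Ideal.span {algebraMap k[X] B π} := by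
    rw [Ideal.map_span, Set.image_singleton]
  have := v.isPrime
  rw [IsScalarTower.algebraMap_apply k[X] B K, ord_ofHeightOne v h0', v.valuation_of_algebraMap,
    v.intValuation_eq_exp_neg_multiplicity h0, WithZero.log_exp, neg_neg,
    Ideal.IsDedekindDomain.ramificationIdx_eq_multiplicity (Ideal.span {π}) v.asIdeal
      (by rw [hmap]; simpa using h0), hmap]

theorem degree_ofHeightOne_of_liesOver {π : k[X]} (hπ : Irreducible π) (v : HeightOneSpectrum B)
    [v.asIdeal.LiesOver (Ideal.span {π})] :
    (ofHeightOne k K v).degree = π.natDegree * v.asIdeal.inertiaDeg k[X] := by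
  have hmax : (Ideal.span {π}).IsMaximal :=
    PrincipalIdealRing.isMaximal_of_irreducible hπ
  have := v.isMaximal
  let := Ideal.Quotient.field (Ideal.span {π})
  have : IsScalarTower k (k[X] ⧸ Ideal.span {π}) (B ⧸ v.asIdeal) :=
    .of_algebraMap_eq fun c => by
      rw [IsScalarTower.algebraMap_apply k k[X] (k[X] ⧸ Ideal.span {π}),
        ← IsScalarTower.algebraMap_apply k[X] (k[X] ⧸ Ideal.span {π}) (B ⧸ v.asIdeal),
        IsScalarTower.algebraMap_apply k[X] B (B ⧸ v.asIdeal),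
        IsScalarTower.algebraMap_apply k B (B ⧸ v.asIdeal),
        IsScalarTower.algebraMap_apply k k[X] B]
  rw [degree_ofHeightOne, Ideal.inertiaDeg_eq_of_isMaximal (Ideal.span {π}) v.asIdeal,
    ← finrank_quotient_span_eq_natDegree (f := π)]
  exact (Module.finrank_mul_finrank k (k[X] ⧸ Ideal.span {π}) (B ⧸ v.asIdeal)).symm

variable (k K B) in
/-- The fundamental identity `∑ eᵢ fᵢ = n`, in terms of the points of the curve. -/
theorem exists_finset_ord_pos {π : k[X]} (hπ : Irreducible π) :
    ∃ F : Finset (CurvePoint k K),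
      (∀ P : CurvePoint k K, P ∈ F ↔ 0 < P.ord (algebraMap k[X] K π)) ∧
      (∀ P ∈ F, 0 < P.degree ∧ P.ord (algebraMap k[X] K π) ≤ finrank k[X] B) ∧
      ∑ P ∈ F, P.ord (algebraMap k[X] K π) * P.degree = finrank k[X] B * π.natDegree := by
  classical
  have hinj := FaithfulSMul.algebraMap_injective k[X] B
  set p : Ideal k[X] := Ideal.span {π} with hp
  have hmax : p.IsMaximal := PrincipalIdealRing.isMaximal_of_irreducible hπ
  have hp0 : p ≠ ⊥ := by simpa [hp] using hπ.ne_zero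
  have hq0 : ∀ q : p.primesOver B, q.1 ≠ ⊥ := fun q =>
    have := q.2.2
    Ideal.ne_bot_of_liesOver_of_ne_bot hp0 q.1
  let v : p.primesOver B → HeightOneSpectrum B := fun q => ⟨q.1, q.2.1, hq0 q⟩
  have hv (q) : (v q).asIdeal.LiesOver (Ideal.span {π}) := q.2.2
  have hvinj : Function.Injective v := fun q q' h =>
    Subtype.ext (congrArg HeightOneSpectrum.asIdeal h)
  let pt : p.primesOver B → CurvePoint k K := fun q => ofHeightOne k K (v q)
  have hptinj : Function.Injective pt := (ofHeightOne_injective k K).comp hvinj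
  have hdeg : 0 < π.natDegree := hπ.natDegree_pos
  have hord : ∀ q, (pt q).ord (algebraMap k[X] K π) = q.1.ramificationIdx k[X] := fun q =>
    ord_ofHeightOne_of_liesOver hπ.ne_zero (v q)
  have hdegree : ∀ q, (pt q).degree = π.natDegree * q.1.inertiaDeg k[X] := fun q =>
    degree_ofHeightOne_of_liesOver hπ (v q)
  have hi : ∀ q : p.primesOver B, 0 < q.1.inertiaDeg k[X] := fun q =>
    have := q.2.1
    q.1.inertiaDeg_pos k[X]
  have he : ∀ q : p.primesOver B, 0 < q.1.ramificationIdx k[X] := fun q =>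
    have := q.2.1
    q.1.ramificationIdx_pos k[X]
  have hsum := Ideal.sum_ramification_inertia_eq_finrank p B
  refine ⟨Finset.univ.map ⟨pt, hptinj⟩, fun P => ?_, fun P hP => ?_, ?_⟩
  · simp only [Finset.mem_map, Finset.mem_univ, true_and, Function.Embedding.coeFn_mk]
    constructor
    · rintro ⟨q, rfl⟩
      rw [hord]
      exact_mod_cast he q
    · intro hP
      -- A polynomial cannot vanish at a pole of its variable. So the local ring of `P` contains
      -- `k[X]`, hence also `B`, which is integral over it, and `P` comes from a prime of `B`.
      have hz : 0 ≤ P.ord (algebraMap k[X] K X) := by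
        rw [algebraMap_eq_aeval] at hP
        exact P.ord_nonneg_of_ord_aeval_pos hP
      obtain ⟨w, rfl⟩ := P.exists_ofHeightOne_eq (B := B) fun b =>
        P.mem_ring_of_isIntegral hz ((Algebra.IsIntegral.isIntegral (R := k[X]) b).algebraMap)
      have hw : algebraMap k[X] B π ∈ w.asIdeal := by
        rwa [IsScalarTower.algebraMap_apply k[X] B K, ord_ofHeightOne_pos_iff] at hP
        rw [Ne, map_eq_zero_iff _ hinj]
        exact hπ.ne_zero
      refine ⟨⟨w.asIdeal, w.isPrime, ⟨hmax.eq_of_le ?_ ?_⟩⟩, rfl⟩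
      · have := w.isPrime
        exact (Ideal.comap_isPrime (algebraMap k[X] B) w.asIdeal).ne_top
      · rw [hp, Ideal.span_singleton_le_iff_mem]
        exact hw
  · obtain ⟨q, -, rfl⟩ := Finset.mem_map.1 hP
    refine ⟨?_, ?_⟩
    · change 0 < (pt q).degree
      rw [hdegree]
      exact Nat.mul_pos hdeg (hi q)
    · change (pt q).ord _ ≤ _
      rw [hord, ← hsum]
      norm_cast
      refine le_trans (Nat.le_mul_of_pos_right _ (hi q)) ?_
      exact Finset.single_le_sum (f := fun q : p.primesOver B =>
        q.1.ramificationIdx k[X] * q.1.inertiaDeg k[X]) (fun _ _ => Nat.zero_le _)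
        (Finset.mem_univ q)
  · rw [Finset.sum_map, ← hsum]
    push_cast
    rw [Finset.sum_mul]
    refine Finset.sum_congr rfl fun q _ => ?_
    change (pt q).ord _ * ((pt q).degree : ℤ) = _
    rw [hord, hdegree]
    push_cast
    ring

end FundamentalIdentity

end CurvePoint

/-! ### Quadratic extensions of the rational function field -/

/-- `K` is the quadratic extension `k(z)(w)` of the rational function field `k(z)`, and `w²` is a
polynomial in `z`. -/
structure IsQuadraticModel (k : Type*) {K : Type*} [Field k] [Field K] [Algebra k K] (z w : K) :
    Prop where
  exists_eq : ∀ f : K, ∃ a b c : k[X],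
    aeval z c ≠ 0 ∧ f * aeval z c = aeval z a + aeval z b * w
  indep : ∀ a b : k[X], aeval z a + aeval z b * w = 0 → a = 0 ∧ b = 0
  exists_sq : ∃ s : k[X], w ^ 2 = aeval z s

namespace IsQuadraticModel

open Module

variable {k K : Type*} [Field k] [Field K] [Algebra k K] {z w : K}

theorem aeval_injective (h : IsQuadraticModel k z w) :
    Function.Injective (aeval z : k[X] →ₐ[k] K) := by
  rw [injective_iff_map_eq_zero]
  intro a ha
  exact (h.indep a 0 (by simp [ha])).1

theorem aeval_ne_zero (h : IsQuadraticModel k z w) {p : k[X]} (hp : p ≠ 0) : aeval z p ≠ 0 := by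
  rwa [Ne, map_eq_zero_iff _ h.aeval_injective]

/-- The points over an irreducible polynomial in `z`. -/
theorem exists_finset_ord_pos (h : IsQuadraticModel k z w) (h2 : (2 : k) ≠ 0) {π : k[X]}
    (hπ : Irreducible π) :
    ∃ F : Finset (CurvePoint k K),
      (∀ P : CurvePoint k K, P ∈ F ↔ 0 < P.ord (aeval z π)) ∧
      (∀ P ∈ F, 0 < P.degree ∧ P.ord (aeval z π) ≤ 2) ∧
      ∑ P ∈ F, P.ord (aeval z π) * P.degree = 2 * π.natDegree := by
  let : Algebra k[X] K := (aeval z : k[X] →ₐ[k] K).toRingHom.toAlgebra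
  have hmap : ∀ p : k[X], algebraMap k[X] K p = aeval z p := fun _ => rfl
  have : IsScalarTower k k[X] K := .of_algebraMap_eq fun c => (aeval_C z c).symm
  have : FaithfulSMul k[X] K := (faithfulSMul_iff_algebraMap_injective _ _).2 h.aeval_injective
  let : Algebra (FractionRing k[X]) K := FractionRing.liftAlgebra k[X] K
  have : IsScalarTower k[X] (FractionRing k[X]) K := FractionRing.isScalarTower_liftAlgebra k[X] K
  have hli : LinearIndependent (FractionRing k[X]) ![(1 : K), w] := by
    rw [← LinearIndependent.iff_fractionRing k[X], LinearIndependent.pair_iff]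
    intro a b hab
    refine h.indep a b ?_
    simpa [Algebra.smul_def, hmap] using hab
  have hex : ∀ f : K, ∃ a b : FractionRing k[X], f = algebraMap _ K a + algebraMap _ K b * w := by
    intro f
    obtain ⟨a, b, c, hc, hf⟩ := h.exists_eq f
    refine ⟨algebraMap _ _ a / algebraMap _ _ c, algebraMap _ _ b / algebraMap _ _ c, ?_⟩
    simp only [map_div₀, ← IsScalarTower.algebraMap_apply k[X] (FractionRing k[X]) K, hmap]
    field_simp
    exact hf
  have hsp : ⊤ ≤ Submodule.span (FractionRing k[X]) (Set.range ![(1 : K), w]) := by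
    intro f _
    obtain ⟨a, b, rfl⟩ := hex f
    rw [Matrix.range_cons, Matrix.range_cons, Matrix.range_empty, Set.union_empty,
      Set.singleton_union, Submodule.mem_span_pair]
    exact ⟨a, b, by simp [Algebra.smul_def]⟩
  let bas := Basis.mk hli hsp
  have : FiniteDimensional (FractionRing k[X]) K := bas.finiteDimensional_of_finite
  have hfin : finrank (FractionRing k[X]) K = 2 := by
    rw [finrank_eq_card_basis bas, Fintype.card_fin]
  -- As the characteristic is not 2, `X² - s` is separable. Separability makes the integral closure
  -- of `k[X]` in `K` a finite `k[X]`-module, to which the fundamental identity applies.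
  have hw : IsSeparable (FractionRing k[X]) w := by
    obtain ⟨s, hs⟩ := h.exists_sq
    have hw0 : w ≠ 0 := by
      rintro rfl
      simpa using (h.indep 0 1 (by simp)).2
    have hs0 : s ≠ 0 := by
      rintro rfl
      simp [hw0] at hs
    have h2' : ((2 : ℕ) : FractionRing k[X]) ≠ 0 := by
      have := (map_ne_zero_iff _ (FaithfulSMul.algebraMap_injective k (FractionRing k[X]))).2 h2
      rw [map_ofNat] at this
      exact_mod_cast this
    refine (separable_X_pow_sub_C (algebraMap k[X] (FractionRing k[X]) s) h2' (by simpa)).of_dvd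
      (minpoly.dvd _ _ ?_)
    simp only [map_sub, map_pow, aeval_X, aeval_C]
    rw [← IsScalarTower.algebraMap_apply k[X] (FractionRing k[X]) K, hmap, hs, sub_self]
  have : Algebra.IsSeparable (FractionRing k[X]) K := by
    refine ⟨fun f => ?_⟩
    obtain ⟨a, b, rfl⟩ := hex f
    have hmem := fun x => (separableClosure (FractionRing k[X]) K).algebraMap_mem x
    exact mem_separableClosure_iff.1
      (add_mem (hmem a) (mul_mem (hmem b) (mem_separableClosure_iff.2 hw)))
  let B := integralClosure k[X] K
  have : IsFractionRing B K := integralClosure.isFractionRing_of_finite_extension (FractionRing k[X]) K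
  have : Module.Finite k[X] B := IsIntegralClosure.finite k[X] (FractionRing k[X]) K B
  have : IsDedekindDomain B := IsIntegralClosure.isDedekindDomain k[X] (FractionRing k[X]) K B
  have hfinB : finrank k[X] B = 2 := by
    rw [← hfin]
    exact (IsFractionRing.finrank_eq k[X] (FractionRing k[X]) B K).symm
  obtain ⟨F, hF⟩ := CurvePoint.exists_finset_ord_pos k K B hπ
  refine ⟨F, ?_⟩
  rw [hfinB] at hF
  exact hF

end IsQuadraticModel

/-! ### The sextic model: points at infinity and divisors of polynomials in `t` -/

theorem Polynomial.aeval_inv_reflect_mul_pow {k K : Type*} [Field k] [Field K] [Algebra k K]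
    {t : K} (ht : t ≠ 0) {p : k[X]} {N : ℕ} (hN : p.natDegree ≤ N) :
    aeval t⁻¹ (reflect N p) * t ^ N = aeval t p := by
  have := invertibleOfNonzero ht
  have h := eval₂_reflect_mul_pow (algebraMap k K) t N p hN
  rwa [invOf_eq_inv] at h

/-- A function field `K = k(t, u)` with `u² = S(t)` for a squarefree sextic `S`, together with its
hyperelliptic involution. -/
structure SexticModel (k K : Type*) [Field k] [Field K] [Algebra k K] where
  S : k[X]
  t : K
  u : K
  σ : K ≃ₐ[k] K
  two_ne : (2 : k) ≠ 0
  natDegree_eq : S.natDegree = 6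
  squarefree : Squarefree S
  sq : u ^ 2 = aeval t S
  quad : IsQuadraticModel k t u
  map_t : σ t = t
  map_u : σ u = -u

namespace SexticModel

variable {k K : Type*} [Field k] [Field K] [Algebra k K] (M : SexticModel k K)

theorem t_ne_zero : M.t ≠ 0 := by
  simpa using M.quad.aeval_ne_zero (p := X) X_ne_zero

theorem S_ne_zero : M.S ≠ 0 := M.squarefree.ne_zero

theorem u_ne_zero : M.u ≠ 0 := by
  intro h
  have := M.sq
  rw [h, zero_pow two_ne_zero] at this
  exact M.quad.aeval_ne_zero M.S_ne_zero this.symm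

theorem map_aeval (p : k[X]) : M.σ (aeval M.t p) = aeval M.t p := by
  have := aeval_algHom_apply (M.σ : K →ₐ[k] K) M.t p
  simpa [M.map_t] using this.symm

/-- The chart at infinity: `(u / t³)²` is the reversed sextic in `1 / t`. It turns poles of `t` into
zeros of a coordinate. -/
theorem quad_inv : IsQuadraticModel k M.t⁻¹ (M.u / M.t ^ 3) where
  exists_eq f := by
    obtain ⟨a, b, c, hc, hf⟩ := M.quad.exists_eq f
    have ht := M.t_ne_zero
    set N := max a.natDegree (max b.natDegree c.natDegree) with hN
    have ha := aeval_inv_reflect_mul_pow M.t_ne_zero (p := a) (N := N) (by omega)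
    have hb := aeval_inv_reflect_mul_pow M.t_ne_zero (p := b) (N := N) (by omega)
    have hc' := aeval_inv_reflect_mul_pow M.t_ne_zero (p := c) (N := N) (by omega)
    refine ⟨reflect N a * X ^ 3, reflect N b, reflect N c * X ^ 3, ?_, ?_⟩
    · rw [map_mul, map_pow, aeval_X]
      refine mul_ne_zero (fun h0 => hc ?_) (pow_ne_zero _ (inv_ne_zero ht))
      rw [← hc', h0, zero_mul]
    · rw [← ha, ← hb, ← hc'] at hf
      have htN : M.t ^ N ≠ 0 := pow_ne_zero _ ht
      have hf' : f * aeval M.t⁻¹ (reflect N c) =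
          aeval M.t⁻¹ (reflect N a) + aeval M.t⁻¹ (reflect N b) * M.u :=
        mul_right_cancel₀ htN (by linear_combination hf)
      simp only [map_mul, map_pow, aeval_X]
      have h3 : M.t⁻¹ ^ 3 * M.t ^ 3 = 1 := by rw [← mul_pow, inv_mul_cancel₀ ht, one_pow]
      have hu : M.u / M.t ^ 3 = M.u * M.t⁻¹ ^ 3 := by rw [inv_pow, div_eq_mul_inv]
      rw [hu]
      linear_combination M.t⁻¹ ^ 3 * hf'
  indep a b hab := by
    set N := max a.natDegree b.natDegree with hN
    have ht := M.t_ne_zero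
    have ha := aeval_inv_reflect_mul_pow (inv_ne_zero ht) (p := a) (N := N) (by omega)
    have hb := aeval_inv_reflect_mul_pow (inv_ne_zero ht) (p := b) (N := N) (by omega)
    rw [inv_inv] at ha hb
    have h := M.quad.indep (reflect N a * X ^ 3) (reflect N b) (by
      rw [← ha, ← hb] at hab
      simp only [map_mul, map_pow, aeval_X]
      have hN : M.t⁻¹ ^ N * M.t ^ N = 1 := by rw [← mul_pow, inv_mul_cancel₀ ht, one_pow]
      have hu : M.u / M.t ^ 3 * M.t ^ 3 = M.u := by field_simp
      linear_combination M.t ^ N * M.t ^ 3 * hab -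
        (aeval M.t (reflect N a) * M.t ^ 3 + aeval M.t (reflect N b) * M.u) * hN -
        aeval M.t (reflect N b) * M.t⁻¹ ^ N * M.t ^ N * hu)
    have h1 := (mul_eq_zero.1 h.1).resolve_right (pow_ne_zero _ X_ne_zero)
    exact ⟨reflect_eq_zero_iff.1 h1, reflect_eq_zero_iff.1 h.2⟩
  exists_sq := by
    refine ⟨reflect 6 M.S, ?_⟩
    have ht := M.t_ne_zero
    rw [div_pow, M.sq, ← aeval_inv_reflect_mul_pow ht M.natDegree_eq.le]
    field_simp

/-- Poles of `t` are zeros of `1 / t`, so the fundamental identity for `X` in the chart at infinity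
yields both the total degree 2 and the positivity of the local degrees. -/
theorem exists_poles : ∃ Z : CurveDivisor k K,
    (∀ P, Z P = max 0 (-P.ord M.t)) ∧ CurveDivisor.deg k K Z = 2 ∧
      ∀ P : CurvePoint k K, P.ord M.t < 0 → 0 < P.degree := by
  obtain ⟨F, hF, hdeg, hsum⟩ := M.quad_inv.exists_finset_ord_pos M.two_ne irreducible_X
  simp only [aeval_X, CurvePoint.ord_inv, natDegree_X] at hF hdeg hsum
  refine ⟨Finsupp.onFinset F (fun P => max 0 (-P.ord M.t)) fun P hP => ?_, fun P => rfl, ?_,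
    fun P hP => (hdeg P ((hF P).2 (by omega))).1⟩
  · rw [hF]
    by_contra! h
    exact hP (max_eq_left h)
  · simp only [CurveDivisor.deg, Finsupp.liftAddHom_apply, AddMonoidHom.coe_mulRight]
    rw [Finsupp.onFinset_sum _ (by simp)]
    refine Eq.trans (Finset.sum_congr rfl fun P hP => ?_) (hsum.trans (by norm_num))
    rw [max_eq_right ((hF P).1 hP).le]

/-- The divisor of poles of `t`. -/
def poles : CurveDivisor k K := M.exists_poles.choose

theorem poles_apply (P : CurvePoint k K) : M.poles P = max 0 (-P.ord M.t) :=
  M.exists_poles.choose_spec.1 P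

theorem deg_poles : CurveDivisor.deg k K M.poles = 2 :=
  M.exists_poles.choose_spec.2.1

theorem poles_nonneg (P : CurvePoint k K) : 0 ≤ M.poles P := by
  rw [poles_apply]
  exact le_max_left _ _

theorem poles_of_nonneg {P : CurvePoint k K} (hP : 0 ≤ P.ord M.t) : M.poles P = 0 := by
  rw [poles_apply]
  omega

theorem poles_of_neg {P : CurvePoint k K} (hP : P.ord M.t < 0) : M.poles P = -P.ord M.t := by
  rw [poles_apply]
  omega

theorem exists_ord_t_neg : ∃ P : CurvePoint k K, P.ord M.t < 0 := by
  by_contra! h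
  have h0 : M.poles = 0 := Finsupp.ext fun P => M.poles_of_nonneg (h P)
  have := M.deg_poles
  rw [h0, map_zero] at this
  exact absurd this (by norm_num)

theorem ord_u_of_neg {P : CurvePoint k K} (hP : P.ord M.t < 0) : P.ord M.u = 3 * P.ord M.t := by
  have h := (P.ord_aeval_of_neg hP M.S_ne_zero).2
  rw [← M.sq, P.ord_pow, M.natDegree_eq] at h
  push_cast at h
  omega

theorem ord_aeval_nonneg {P : CurvePoint k K} (hP : 0 ≤ P.ord M.t) (p : k[X]) :
    0 ≤ P.ord (aeval M.t p) := by
  rcases eq_or_ne (aeval M.t p) 0 with h | h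
  · rw [h, P.ord_zero]
  · exact (P.ord_nonneg_iff h).2 (P.aeval_mem_ring hP p)

theorem ord_u_nonneg {P : CurvePoint k K} (hP : 0 ≤ P.ord M.t) : 0 ≤ P.ord M.u := by
  have h := M.ord_aeval_nonneg hP M.S
  rw [← M.sq, P.ord_pow] at h
  push_cast at h
  omega

/-- The bound 2 on the ramification index is what later makes it prime to 3. -/
theorem exists_point_over {π : k[X]} (hπ : Irreducible π) :
    ∃ P : CurvePoint k K, 0 ≤ P.ord M.t ∧ 0 < P.ord (aeval M.t π) ∧ P.ord (aeval M.t π) ≤ 2 := by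
  obtain ⟨F, hF, hdeg, hsum⟩ := M.quad.exists_finset_ord_pos M.two_ne hπ
  have hne : F.Nonempty := by
    by_contra h
    rw [Finset.not_nonempty_iff_eq_empty.1 h, Finset.sum_empty] at hsum
    have := hπ.natDegree_pos
    omega
  obtain ⟨P, hP⟩ := hne
  exact ⟨P, P.ord_nonneg_of_ord_aeval_pos ((hF P).1 hP), (hF P).1 hP, (hdeg P hP).2⟩

theorem ord_aeval_mul (P : CurvePoint k K) {p q : k[X]} (hp : p ≠ 0) (hq : q ≠ 0) :
    P.ord (aeval M.t (p * q)) = P.ord (aeval M.t p) + P.ord (aeval M.t q) := by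
  rw [map_mul, P.ord_mul (M.quad.aeval_ne_zero hp) (M.quad.aeval_ne_zero hq)]

theorem ord_aeval_unit (P : CurvePoint k K) {p : k[X]} (hp : IsUnit p) :
    P.ord (aeval M.t p) = 0 := by
  obtain ⟨c, -, rfl⟩ := Polynomial.isUnit_iff.1 hp
  rw [aeval_C, P.ord_algebraMap]

/-- A Bézout relation would give `1` positive order. The condition on `p` is conditional so that `p
= 0` is allowed. -/
theorem not_isCoprime_of_ord_pos {P : CurvePoint k K} {p q : k[X]} (hP : 0 ≤ P.ord M.t)
    (hp : aeval M.t p ≠ 0 → 0 < P.ord (aeval M.t p)) (hq : 0 < P.ord (aeval M.t q)) :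
    ¬ IsCoprime p q := by
  rintro ⟨a, b, hab⟩
  have hne : ∀ {r : k[X]}, aeval M.t r ≠ 0 → r ≠ 0 := fun h h0 => h (by rw [h0, map_zero])
  have h1 : aeval M.t (a * p) + aeval M.t (b * q) = 1 := by
    rw [← map_add, hab, map_one]
  have h := P.le_ord_add (f := aeval M.t (a * p)) (g := aeval M.t (b * q)) (n := 1)
    (by rw [h1]; exact one_ne_zero)
    (fun h => by
      have h := hne h
      rw [M.ord_aeval_mul P (left_ne_zero_of_mul h) (right_ne_zero_of_mul h)]
      have := M.ord_aeval_nonneg hP a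
      have := hp (M.quad.aeval_ne_zero (right_ne_zero_of_mul h))
      omega)
    (fun h => by
      have h := hne h
      rw [M.ord_aeval_mul P (left_ne_zero_of_mul h) (right_ne_zero_of_mul h)]
      have := M.ord_aeval_nonneg hP b
      omega)
  rw [h1, P.ord_one] at h
  omega

theorem dvd_of_ord_pos {P : CurvePoint k K} {π a : k[X]} (hπ : Irreducible π)
    (hP : 0 < P.ord (aeval M.t π)) (ha : 0 < P.ord (aeval M.t a)) : π ∣ a := by
  by_contra h
  exact M.not_isCoprime_of_ord_pos (P.ord_nonneg_of_ord_aeval_pos hP) (fun _ => hP) ha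
    ((hπ.coprime_iff_not_dvd).2 h)

/-- Divisibility of polynomials can be tested at the points where `t` is finite. -/
theorem dvd_of_ord_le {a c : k[X]} (ha : a ≠ 0) (hc : c ≠ 0)
    (h : ∀ P : CurvePoint k K, 0 ≤ P.ord M.t → P.ord (aeval M.t c) ≤ P.ord (aeval M.t a)) :
    c ∣ a := by
  induction c using WfDvdMonoid.induction_on_irreducible generalizing a with
  | zero => exact absurd rfl hc
  | unit c hu => exact hu.dvd
  | mul c π hc0 hπ ih =>
    obtain ⟨P, hP, hPπ, -⟩ := M.exists_point_over hπ
    have h1 := h P hP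
    rw [M.ord_aeval_mul P hπ.ne_zero hc0] at h1
    have h2 := M.ord_aeval_nonneg hP c
    obtain ⟨a, rfl⟩ := M.dvd_of_ord_pos hπ hPπ (a := a) (by omega)
    have ha' := right_ne_zero_of_mul ha
    refine mul_dvd_mul_left _ (ih ha' hc0 fun Q hQ => ?_)
    have h3 := h Q hQ
    rw [M.ord_aeval_mul Q hπ.ne_zero hc0, M.ord_aeval_mul Q hπ.ne_zero ha'] at h3
    omega

theorem exists_irreducible_ord_pos {P : CurvePoint k K} {p : k[X]} (hp : p ≠ 0)
    (h : 0 < P.ord (aeval M.t p)) : ∃ π : k[X], Irreducible π ∧ 0 < P.ord (aeval M.t π) := by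
  induction p using WfDvdMonoid.induction_on_irreducible with
  | zero => exact absurd rfl hp
  | unit c hu =>
    rw [M.ord_aeval_unit P hu] at h
    exact absurd h (lt_irrefl _)
  | mul c π hc0 hπ ih =>
    by_cases h1 : 0 < P.ord (aeval M.t π)
    · exact ⟨π, hπ, h1⟩
    · rw [M.ord_aeval_mul P hπ.ne_zero hc0] at h
      exact ih hc0 (by omega)

theorem norm_eq (a b : k[X]) : (aeval M.t a + aeval M.t b * M.u) *
    (aeval M.t a - aeval M.t b * M.u) = aeval M.t (a ^ 2 - b ^ 2 * M.S) := by
  simp only [map_sub, map_mul, map_pow, ← M.sq]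
  ring

/-- Every point with `t` finite lies over an irreducible polynomial. -/
theorem exists_irreducible_of_point {P : CurvePoint k K} (hP : 0 ≤ P.ord M.t) :
    ∃ π : k[X], Irreducible π ∧ 0 < P.ord (aeval M.t π) := by
  by_contra! hno
  -- If no irreducible vanishes at `P`, all nonzero polynomials have order 0. A function of order 1,
  -- cleared of its denominator, is then some `a + bu` of order 1; its conjugate has order at least
  -- 0, yet their product is a polynomial and has order 0.
  have h0 : ∀ p : k[X], P.ord (aeval M.t p) = 0 := by
    intro p
    by_contra hne
    have hpos := (M.ord_aeval_nonneg hP p).lt_of_ne' hne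
    have hp : p ≠ 0 := by
      rintro rfl
      simp [P.ord_zero] at hne
    obtain ⟨π, hπ, h⟩ := M.exists_irreducible_ord_pos hp hpos
    exact absurd (hno π hπ) (not_le.2 h)
  have hnn : ∀ a b : k[X], 0 ≤ P.ord (aeval M.t a + aeval M.t b * M.u) := by
    intro a b
    by_cases hz : aeval M.t a + aeval M.t b * M.u = 0
    · rw [hz, P.ord_zero]
    refine P.le_ord_add hz (fun _ => (h0 a).ge) fun h => ?_
    rw [P.ord_mul (left_ne_zero_of_mul h) (right_ne_zero_of_mul h), h0]
    simpa using M.ord_u_nonneg hP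
  obtain ⟨f, hf, hf1⟩ := P.exists_ord_eq_one
  obtain ⟨a, b, c, hc, hfc⟩ := M.quad.exists_eq f
  have h1 : P.ord (aeval M.t a + aeval M.t b * M.u) = 1 := by
    rw [← hfc, P.ord_mul hf hc, hf1, h0, add_zero]
  have hne : aeval M.t a + aeval M.t b * M.u ≠ 0 := by
    rw [← hfc]
    exact mul_ne_zero hf hc
  have hconj : aeval M.t a - aeval M.t b * M.u = aeval M.t a + aeval M.t (-b) * M.u := by
    rw [map_neg]
    ring
  have hne' : aeval M.t a + aeval M.t (-b) * M.u ≠ 0 := by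
    intro hz
    obtain ⟨ha, hb⟩ := M.quad.indep _ _ hz
    rw [neg_eq_zero] at hb
    simp [ha, hb] at hne
  have h2 := M.norm_eq a b
  rw [hconj] at h2
  have h3 := P.ord_mul hne hne'
  rw [h2, h0, h1] at h3
  have := hnn a (-b)
  omega

/-- `degree` is a `finrank`, which is 0 for an infinite extension, so positivity encodes finiteness
of the residue field. -/
theorem degree_pos (M : SexticModel k K) (P : CurvePoint k K) : 0 < P.degree := by
  rcases lt_or_ge (P.ord M.t) 0 with hP | hP
  · exact M.exists_poles.choose_spec.2.2 P hP
  · obtain ⟨π, hπ, h⟩ := M.exists_irreducible_of_point hP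
    obtain ⟨F, hF, hdeg, -⟩ := M.quad.exists_finset_ord_pos M.two_ne hπ
    exact (hdeg P ((hF P).2 h)).1

/-- The divisor of a polynomial in `t`. -/
theorem exists_divisor_aeval {p : k[X]} (hp : p ≠ 0) : ∃ D : CurveDivisor k K,
    (∀ P, D P = P.ord (aeval M.t p)) ∧ CurveDivisor.deg k K D = 0 := by
  induction p using WfDvdMonoid.induction_on_irreducible with
  | zero => exact absurd rfl hp
  | unit c hu => exact ⟨0, fun P => (M.ord_aeval_unit P hu).symm, map_zero _⟩
  | mul c π hc0 hπ ih =>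
    obtain ⟨D, hD, hD0⟩ := ih hc0
    obtain ⟨F, hF, hdeg, hsum⟩ := M.quad.exists_finset_ord_pos M.two_ne hπ
    let Z : CurveDivisor k K := Finsupp.onFinset F (fun P => max 0 (P.ord (aeval M.t π)))
      fun P hP => by
        rw [hF]
        by_contra! h
        exact hP (max_eq_left h)
    have hZ : CurveDivisor.deg k K Z = 2 * π.natDegree := by
      simp only [CurveDivisor.deg, Finsupp.liftAddHom_apply, AddMonoidHom.coe_mulRight]
      rw [Finsupp.onFinset_sum _ (by simp), ← hsum]
      refine Finset.sum_congr rfl fun P hP => ?_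
      rw [max_eq_right ((hF P).1 hP).le]
    -- The zeros of `π` have total degree `2 deg π`, matching its pole of order `deg π` along a
    -- divisor of degree 2.
    refine ⟨D + (Z - π.natDegree • M.poles), fun P => ?_, ?_⟩
    · have hZP : Z P = max 0 (P.ord (aeval M.t π)) := rfl
      rw [M.ord_aeval_mul P hπ.ne_zero hc0]
      simp only [Finsupp.add_apply, Finsupp.sub_apply, Finsupp.smul_apply, hD, hZP, nsmul_eq_mul]
      rcases lt_or_ge (P.ord M.t) 0 with hP | hP
      · rw [M.poles_of_neg hP, (P.ord_aeval_of_neg hP hπ.ne_zero).2, max_eq_left]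
        · ring
        · exact mul_nonpos_of_nonneg_of_nonpos (Int.natCast_nonneg _) hP.le
      · rw [M.poles_of_nonneg hP, max_eq_right (M.ord_aeval_nonneg hP π)]
        ring
    · rw [map_add, map_sub, map_nsmul, hD0, hZ, M.deg_poles, nsmul_eq_mul]
      ring

end SexticModel

/-- An irreducible factor of `c` occurs at least twice in `c²` but at most once in `S`, so it
divides `b` and can be cancelled. -/
theorem Polynomial.dvd_of_sq_dvd_sq_mul {k : Type*} [Field k] {b c S : k[X]} (hS : Squarefree S)
    (hc : c ≠ 0) (h : c ^ 2 ∣ b ^ 2 * S) : c ∣ b := by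
  induction c using WfDvdMonoid.induction_on_irreducible generalizing b with
  | zero => exact absurd rfl hc
  | unit c hu => exact hu.dvd
  | mul c π hc0 hπ ih =>
    have hb : π ∣ b := by
      by_contra hb
      have hcop : IsCoprime (π ^ 2) (b ^ 2) := (hπ.coprime_iff_not_dvd.2 hb).pow
      have h1 : π ^ 2 ∣ S := hcop.dvd_of_dvd_mul_left
        ((pow_dvd_pow_of_dvd (dvd_mul_right π c) 2).trans h)
      exact hπ.not_isUnit (hS π (by rwa [← sq]))
    obtain ⟨b, rfl⟩ := hb
    refine mul_dvd_mul_left _ (ih hc0 ?_)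
    rw [mul_pow, mul_pow, mul_assoc] at h
    exact (mul_dvd_mul_iff_left (pow_ne_zero 2 hπ.ne_zero)).1 h

/-! ### Riemann-Roch spaces and their drop in dimension -/

namespace CurveDivisor

variable {k K : Type*} [Field k] [Field K] [Algebra k K]

/-- The Riemann-Roch space of a divisor. -/
def riemannRochSpace (D : CurveDivisor k K) : Submodule k K where
  carrier := {f | f ≠ 0 → ∀ P, -D P ≤ P.ord f}
  zero_mem' := fun h => absurd rfl h
  add_mem' := fun {f g} hf hg hfg P => P.le_ord_add hfg (fun h => hf h P) fun h => hg h P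
  smul_mem' := fun c f hf hcf P => by
    rw [Algebra.smul_def] at hcf ⊢
    rw [P.ord_mul (left_ne_zero_of_mul hcf) (right_ne_zero_of_mul hcf), P.ord_algebraMap, zero_add]
    exact hf (right_ne_zero_of_mul hcf) P

theorem deg_single (P : CurvePoint k K) (n : ℤ) :
    deg k K (Finsupp.single P n) = n * P.degree := by
  simp [deg]

/-- Multiply by `ϖ ^ A P` and reduce modulo the maximal ideal of `P`: this is a linear map to the
residue field, and its kernel consists of sections of `A - P`. -/
theorem finrank_le_inf_sub_single (hdeg : ∀ P : CurvePoint k K, 0 < P.degree)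
    (V : Submodule k K) [FiniteDimensional k V] (A : CurveDivisor k K)
    (hV : V ≤ riemannRochSpace A) (P : CurvePoint k K) :
    Module.finrank k V ≤
      Module.finrank k ↥(V ⊓ riemannRochSpace (A - Finsupp.single P 1)) + P.degree := by
  classical
  obtain ⟨ϖ, hϖ, hϖ1⟩ := P.exists_ord_eq_one
  have hz : ϖ ^ A P ≠ 0 := zpow_ne_zero _ hϖ
  have hord : ∀ f : K, f ≠ 0 → P.ord (ϖ ^ A P * f) = A P + P.ord f := fun f hf => by
    rw [P.ord_mul hz hf, P.ord_zpow, hϖ1, mul_one]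
  have hmem : ∀ f : V, ϖ ^ A P * (f : K) ∈ P.ring := by
    intro f
    apply P.mem_ring_of_ord_nonneg
    rcases eq_or_ne (f : K) 0 with h | h
    · rw [h, mul_zero, P.ord_zero]
    · rw [hord _ h]
      have := hV f.2 h P
      omega
  let φ : V →ₗ[k] P.ring :=
    { toFun := fun f => ⟨ϖ ^ A P * f, hmem f⟩
      map_add' := fun f g => Subtype.ext (mul_add _ _ _)
      map_smul' := fun c f => Subtype.ext (by
        change ϖ ^ A P * (c • (f : K)) = algebraMap k K c * (ϖ ^ A P * (f : K))
        rw [Algebra.smul_def]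
        ring) }
  let ψ : V →ₗ[k] IsLocalRing.ResidueField P.ring :=
    (IsScalarTower.toAlgHom k P.ring (IsLocalRing.ResidueField P.ring)).toLinearMap ∘ₗ φ
  have hψ : ∀ f, ψ f = IsLocalRing.residue P.ring (φ f) := fun f => rfl
  have : Module.Finite k (IsLocalRing.ResidueField P.ring) := Module.finite_of_finrank_pos (hdeg P)
  have hker : ∀ f : V, ψ f = 0 → (f : K) ∈ V ⊓ riemannRochSpace (A - Finsupp.single P 1) := by
    intro f hf
    refine ⟨f.2, fun hf0 Q => ?_⟩
    have h1 := hV f.2 hf0 Q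
    rcases eq_or_ne P Q with rfl | hPQ
    · rw [hψ, IsLocalRing.residue_eq_zero_iff] at hf
      have h2 := (P.mem_maximalIdeal_iff (hmem f) (mul_ne_zero hz hf0)).1 hf
      rw [hord _ hf0] at h2
      simp only [Finsupp.sub_apply, Finsupp.single_eq_same]
      omega
    · simpa [Finsupp.single_apply, hPQ] using h1
  have hle : Module.finrank k (LinearMap.ker ψ) ≤
      Module.finrank k ↥(V ⊓ riemannRochSpace (A - Finsupp.single P 1)) := by
    have : FiniteDimensional k ↥(V ⊓ riemannRochSpace (A - Finsupp.single P 1)) :=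
      Submodule.finiteDimensional_of_le inf_le_left
    let ι : LinearMap.ker ψ →ₗ[k] ↥(V ⊓ riemannRochSpace (A - Finsupp.single P 1)) :=
      LinearMap.codRestrict _ (V.subtype ∘ₗ (LinearMap.ker ψ).subtype) fun f => hker f.1 f.2
    refine LinearMap.finrank_le_finrank_of_injective (f := ι) fun f g h => ?_
    have h' : ((ι f : _) : K) = ((ι g : _) : K) := by rw [h]
    exact Subtype.ext (Subtype.ext h')
  have hrange : Module.finrank k (LinearMap.range ψ) ≤ P.degree := Submodule.finrank_le _
  have := ψ.finrank_range_add_finrank_ker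
  omega

/-- The points of `E` are removed one at a time. Intersecting with a fixed finite-dimensional `V`
makes it unnecessary to know that Riemann-Roch spaces are finite-dimensional. -/
theorem finrank_le_inf_sub (hdeg : ∀ P : CurvePoint k K, 0 < P.degree)
    (V : Submodule k K) [FiniteDimensional k V] (A : CurveDivisor k K)
    (hV : V ≤ riemannRochSpace A) (E : CurvePoint k K →₀ ℕ) :
    (Module.finrank k V : ℤ) ≤
      Module.finrank k ↥(V ⊓ riemannRochSpace (A - E.mapRange (fun n : ℕ => (n : ℤ)) rfl)) +
        deg k K (E.mapRange (fun n : ℕ => (n : ℤ)) rfl) := by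
  classical
  set c : (CurvePoint k K →₀ ℕ) →+ CurveDivisor k K :=
    Finsupp.mapRange.addMonoidHom (Nat.castAddMonoidHom ℤ) with hc
  have hcE : ∀ E : CurvePoint k K →₀ ℕ, E.mapRange (fun n : ℕ => (n : ℤ)) rfl = c E := fun _ => rfl
  have hcs : ∀ P n, c (Finsupp.single P n) = Finsupp.single P (n : ℤ) := fun P n => by
    simp [hc]
  rw [hcE]
  induction E using Finsupp.induction_linear generalizing V A with
  | zero => rw [map_zero, sub_zero, map_zero, add_zero, inf_eq_left.2 hV]
  | add E E' ih ih' =>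
    have : FiniteDimensional k ↥(V ⊓ riemannRochSpace (A - c E)) :=
      Submodule.finiteDimensional_of_le inf_le_left
    have h1 := ih V A hV
    have h2 := ih' (V ⊓ riemannRochSpace (A - c E)) (A - c E) inf_le_right
    have h3 : Module.finrank k
        ↥(V ⊓ riemannRochSpace (A - c E) ⊓ riemannRochSpace (A - c E - c E')) ≤
        Module.finrank k ↥(V ⊓ riemannRochSpace (A - c (E + E'))) := by
      have : FiniteDimensional k ↥(V ⊓ riemannRochSpace (A - c (E + E'))) :=
        Submodule.finiteDimensional_of_le inf_le_left
      refine Submodule.finrank_mono (le_inf (inf_le_left.trans inf_le_left) ?_)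
      rw [map_add, ← sub_sub]
      exact inf_le_right
    rw [map_add, map_add]
    rw [map_add] at h3
    have h3' : (Module.finrank k
        ↥(V ⊓ riemannRochSpace (A - c E) ⊓ riemannRochSpace (A - c E - c E')) : ℤ) ≤
        Module.finrank k ↥(V ⊓ riemannRochSpace (A - (c E + c E'))) := by exact_mod_cast h3
    linarith
  | single P n =>
    induction n generalizing V A with
    | zero =>
      rw [Finsupp.single_zero, map_zero, sub_zero, map_zero, add_zero, inf_eq_left.2 hV]
    | succ n ih =>
      have : FiniteDimensional k ↥(V ⊓ riemannRochSpace (A - Finsupp.single P 1)) :=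
        Submodule.finiteDimensional_of_le inf_le_left
      have h1 := finrank_le_inf_sub_single hdeg V A hV P
      have h2 := ih (V ⊓ riemannRochSpace (A - Finsupp.single P 1)) (A - Finsupp.single P 1)
        inf_le_right
      have hs : c (Finsupp.single P (n + 1)) = Finsupp.single P 1 + c (Finsupp.single P n) := by
        rw [hcs, hcs, ← Finsupp.single_add]
        congr 1
        push_cast
        ring
      have h3 : Module.finrank k ↥(V ⊓ riemannRochSpace (A - Finsupp.single P 1) ⊓
          riemannRochSpace (A - Finsupp.single P 1 - c (Finsupp.single P n))) ≤
          Module.finrank k ↥(V ⊓ riemannRochSpace (A - c (Finsupp.single P (n + 1)))) := by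
        have : FiniteDimensional k ↥(V ⊓ riemannRochSpace (A - c (Finsupp.single P (n + 1)))) :=
          Submodule.finiteDimensional_of_le inf_le_left
        refine Submodule.finrank_mono (le_inf (inf_le_left.trans inf_le_left) ?_)
        rw [hs, ← sub_sub]
        exact inf_le_right
      rw [hcs, deg_single] at h2 ⊢
      rw [hcs, hcs] at h3
      push_cast at h2 h3 ⊢
      have h1' : (Module.finrank k V : ℤ) ≤ Module.finrank k
        ↥(V ⊓ riemannRochSpace (A - Finsupp.single P 1)) + P.degree := by exact_mod_cast h1
      have h3' : (Module.finrank k ↥(V ⊓ riemannRochSpace (A - Finsupp.single P 1) ⊓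
          riemannRochSpace (A - Finsupp.single P 1 - Finsupp.single P (n : ℤ))) : ℤ) ≤
          Module.finrank k ↥(V ⊓ riemannRochSpace (A - Finsupp.single P ((n : ℤ) + 1))) := by
        exact_mod_cast h3
      linarith

end CurveDivisor

theorem CurvePoint.ord_two {k K : Type*} [Field k] [Field K] [Algebra k K] (P : CurvePoint k K) :
    P.ord (2 : K) = 0 := by
  have := P.ord_algebraMap (2 : k)
  rwa [map_ofNat] at this

/-! ### Functions with poles at infinity, Riemann's inequality, degrees of principal divisors -/

namespace SexticModel

variable {k K : Type*} [Field k] [Field K] [Algebra k K] (M : SexticModel k K)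

theorem poles_comap (P : CurvePoint k K) : M.poles (P.comap M.σ) = M.poles P := by
  rw [poles_apply, poles_apply, P.ord_comap, M.map_t]

theorem two_ne_zero_K (M : SexticModel k K) : (2 : K) ≠ 0 := by
  have := (map_ne_zero (algebraMap k K)).2 M.two_ne
  rwa [map_ofNat] at this

/-- The functions with poles bounded by `n` times the divisor of poles of `t`. -/
theorem exists_eq_of_neg_poles_le {f : K} {n : ℕ}
    (h : ∀ P : CurvePoint k K, -(n * M.poles P) ≤ P.ord f) :
    ∃ a b : k[X], f = aeval M.t a + aeval M.t b * M.u ∧ a.natDegree ≤ n ∧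
      (b ≠ 0 → b.natDegree + 3 ≤ n) := by
  obtain ⟨a, b, c, hc, hfc⟩ := M.quad.exists_eq f
  have hc0 : c ≠ 0 := fun h0 => hc (by rw [h0, map_zero])
  have h2 := M.two_ne_zero_K
  have hσf : ∀ P : CurvePoint k K, -(n * M.poles P) ≤ P.ord (M.σ f) := fun P => by
    have := h (P.comap M.σ)
    rwa [P.ord_comap, M.poles_comap] at this
  have hσfc : M.σ f * aeval M.t c = aeval M.t a - aeval M.t b * M.u := by
    have := congrArg M.σ hfc
    simp only [map_mul, map_add, M.map_aeval, M.map_u] at this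
    rw [this]
    ring
  have hac : c ∣ a := by
    rcases eq_or_ne a 0 with rfl | ha
    · exact dvd_zero c
    refine M.dvd_of_ord_le ha hc0 fun P hP => ?_
    -- The trace `f + σ f = 2a / c` has no pole where `t` is finite, so `c` divides `a`.
    have hsum : (f + M.σ f) * aeval M.t c = 2 * aeval M.t a := by
      linear_combination hfc + hσfc
    have ha' := M.quad.aeval_ne_zero ha
    have hne : f + M.σ f ≠ 0 := left_ne_zero_of_mul (hsum ▸ mul_ne_zero h2 ha')
    have h1 := P.le_ord_add hne (fun _ => h P) fun _ => hσf P
    have h3 := congrArg P.ord hsum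
    rw [P.ord_mul hne hc, P.ord_mul h2 ha', P.ord_two] at h3
    rw [M.poles_of_nonneg hP] at h1
    omega
  have hbc : c ∣ b := by
    rcases eq_or_ne b 0 with rfl | hb
    · exact dvd_zero c
    refine dvd_of_sq_dvd_sq_mul M.squarefree hc0 ?_
    have hbS : b ^ 2 * M.S ≠ 0 := mul_ne_zero (pow_ne_zero _ hb) M.S_ne_zero
    refine M.dvd_of_ord_le hbS (pow_ne_zero _ hc0) fun P hP => ?_
    -- Squaring `f - σ f = 2bu / c` eliminates `u` and gives `c² ∣ b² S`; squarefreeness of `S` then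
    -- yields `c ∣ b`.
    have hdiff : (f - M.σ f) ^ 2 * aeval M.t (c ^ 2) = 2 ^ 2 * aeval M.t (b ^ 2 * M.S) := by
      simp only [map_mul, map_pow, ← M.sq]
      have hd : (f - M.σ f) * aeval M.t c = 2 * aeval M.t b * M.u := by
        linear_combination hfc - hσfc
      linear_combination ((f - M.σ f) * aeval M.t c + 2 * aeval M.t b * M.u) * hd
    have hbS' := M.quad.aeval_ne_zero hbS
    have hne2 : (f - M.σ f) ^ 2 ≠ 0 :=
      left_ne_zero_of_mul (hdiff ▸ mul_ne_zero (pow_ne_zero 2 h2) hbS')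
    have hne : f - M.σ f ≠ 0 := fun h0 => hne2 (by rw [h0, zero_pow two_ne_zero])
    have h1 := P.le_ord_sub hne (fun _ => h P) fun _ => hσf P
    have h3 := congrArg P.ord hdiff
    rw [P.ord_mul hne2 (M.quad.aeval_ne_zero (pow_ne_zero _ hc0)),
      P.ord_mul (pow_ne_zero 2 h2) hbS', P.ord_pow, P.ord_pow, P.ord_two] at h3
    rw [M.poles_of_nonneg hP] at h1
    push_cast at h3
    linarith
  obtain ⟨a, rfl⟩ := hac
  obtain ⟨b, rfl⟩ := hbc
  have hfe : f = aeval M.t a + aeval M.t b * M.u := by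
    apply mul_right_cancel₀ hc
    rw [hfc, map_mul, map_mul]
    ring
  have hσe : M.σ f = aeval M.t a - aeval M.t b * M.u := by
    rw [hfe, map_add, map_mul, M.map_aeval, M.map_aeval, M.map_u]
    ring
  -- One pole of `t` suffices for the degree bounds: there `a` has order `deg a · ord t` and `bu`
  -- has order `(deg b + 3) · ord t`.
  obtain ⟨P, hP⟩ := M.exists_ord_t_neg
  have hfP := h P
  have hσP := hσf P
  rw [M.poles_of_neg hP] at hfP hσP
  refine ⟨a, b, hfe, ?_, fun hb => ?_⟩
  · rcases eq_or_ne a 0 with rfl | ha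
    · simp
    have hsum : f + M.σ f = 2 * aeval M.t a := by
      linear_combination hfe + hσe
    have ha' := M.quad.aeval_ne_zero ha
    have hne : f + M.σ f ≠ 0 := hsum ▸ mul_ne_zero h2 ha'
    have h1 := P.le_ord_add hne (fun _ => hfP) fun _ => hσP
    rw [hsum, P.ord_mul h2 ha', P.ord_two, (P.ord_aeval_of_neg hP (right_ne_zero_of_mul
      (mul_ne_zero hc0 ha))).2] at h1
    have : (a.natDegree : ℤ) ≤ n := by nlinarith
    exact_mod_cast this
  · have hdiff : f - M.σ f = 2 * (aeval M.t b * M.u) := by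
      linear_combination hfe - hσe
    have hb' := M.quad.aeval_ne_zero hb
    have hbu := mul_ne_zero hb' M.u_ne_zero
    have hne : f - M.σ f ≠ 0 := hdiff ▸ mul_ne_zero h2 hbu
    have h1 := P.le_ord_sub hne (fun _ => hfP) fun _ => hσP
    rw [hdiff, P.ord_mul h2 hbu, P.ord_two, P.ord_mul hb' M.u_ne_zero,
      (P.ord_aeval_of_neg hP hb).2, M.ord_u_of_neg hP] at h1
    have : (b.natDegree : ℤ) + 3 ≤ n := by nlinarith
    exact_mod_cast this

/-- A function without poles is constant. -/
theorem exists_eq_algebraMap (M : SexticModel k K) {f : K} (hf : f ≠ 0) (h : ∀ P : CurvePoint k K, 0 ≤ P.ord f) :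
    ∃ c : k, c ≠ 0 ∧ f = algebraMap k K c := by
  obtain ⟨a, b, hfe, ha, hb⟩ := M.exists_eq_of_neg_poles_le (f := f) (n := 0) (by simpa using h)
  have hb0 : b = 0 := by
    by_contra h0
    have := hb h0
    omega
  rw [eq_C_of_natDegree_le_zero ha, hb0, map_zero, zero_mul, add_zero, aeval_C] at hfe
  refine ⟨_, fun h0 => hf ?_, hfe⟩
  rw [hfe, h0, map_zero]

/-- Subtracting the divisor of such a `p` leaves `D` with positive coefficients only at poles of
`t`. -/
theorem exists_le_ord_aeval (D : CurveDivisor k K) : ∃ p : k[X], p ≠ 0 ∧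
    ∀ P : CurvePoint k K, 0 ≤ P.ord M.t → D P ≤ P.ord (aeval M.t p) := by
  classical
  induction D using Finsupp.induction_linear with
  | zero => exact ⟨1, one_ne_zero, fun P _ => by simp [P.ord_one]⟩
  | add D E hD hE =>
    obtain ⟨p, hp, h⟩ := hD
    obtain ⟨q, hq, h'⟩ := hE
    exact ⟨p * q, mul_ne_zero hp hq, fun P hP => by
      rw [M.ord_aeval_mul P hp hq]
      exact add_le_add (h P hP) (h' P hP)⟩
  | single Q n =>
    by_cases hQ : 0 ≤ Q.ord M.t
    · obtain ⟨π, hπ, hpos⟩ := M.exists_irreducible_of_point hQ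
      refine ⟨π ^ n.natAbs, pow_ne_zero _ hπ.ne_zero, fun P hP => ?_⟩
      rcases eq_or_ne Q P with rfl | hne
      · rw [Finsupp.single_eq_same, map_pow, Q.ord_pow]
        have : n ≤ n.natAbs := Int.le_natAbs
        nlinarith [Int.natCast_nonneg n.natAbs]
      · rw [Finsupp.single_apply, if_neg hne]
        exact M.ord_aeval_nonneg hP _
    · refine ⟨1, one_ne_zero, fun P hP => ?_⟩
      rw [Finsupp.single_apply, if_neg (by rintro rfl; exact hQ hP)]
      exact M.ord_aeval_nonneg hP _

/-- The functions `a(t) + b(t) u` with `deg a ≤ m + 2` and `deg b < m`. -/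
theorem exists_submodule_finrank (m : ℕ) : ∃ V : Submodule k K, FiniteDimensional k V ∧
    Module.finrank k V = 2 * m + 3 ∧ V ≤ CurveDivisor.riemannRochSpace ((m + 2) • M.poles) := by
  let Φ : (degreeLT k (m + 3) × degreeLT k m) →ₗ[k] K :=
    LinearMap.coprod ((aeval M.t).toLinearMap ∘ₗ (degreeLT k (m + 3)).subtype)
      (LinearMap.mulRight k M.u ∘ₗ (aeval M.t).toLinearMap ∘ₗ (degreeLT k m).subtype)
  have hΦ : ∀ x, Φ x = aeval M.t (x.1 : k[X]) + aeval M.t (x.2 : k[X]) * M.u := fun x => rfl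
  have hinj : Function.Injective Φ := by
    rw [injective_iff_map_eq_zero]
    rintro ⟨a, b⟩ h
    obtain ⟨h1, h2⟩ := M.quad.indep a b h
    ext1
    · exact Subtype.ext h1
    · exact Subtype.ext h2
  have hf : ∀ n, FiniteDimensional k (degreeLT k n) := fun n =>
    (degreeLTEquiv k n).symm.finiteDimensional
  have hr : ∀ n, Module.finrank k (degreeLT k n) = n := fun n => by
    rw [(degreeLTEquiv k n).finrank_eq, Module.finrank_fin_fun]
  have := hf m
  have := hf (m + 3)
  refine ⟨LinearMap.range Φ, inferInstance, ?_, ?_⟩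
  · rw [LinearMap.finrank_range_of_inj hinj, Module.finrank_prod, hr, hr]
    ring
  · rintro _ ⟨⟨⟨a, ha⟩, ⟨b, hb⟩⟩, rfl⟩
    rw [hΦ]
    intro hne P
    simp only [Finsupp.smul_apply, nsmul_eq_mul]
    rcases lt_or_ge (P.ord M.t) 0 with hP | hP
    · rw [M.poles_of_neg hP]
      refine P.le_ord_add hne (fun h => ?_) fun h => ?_
      · have ha0 : a ≠ 0 := by
          rintro rfl
          simp at h
        rw [(P.ord_aeval_of_neg hP ha0).2]
        rw [mem_degreeLT, ← natDegree_lt_iff_degree_lt ha0] at ha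
        have : (a.natDegree : ℤ) ≤ (m + 2 : ℕ) := by exact_mod_cast Nat.le_of_lt_succ ha
        nlinarith
      · have hb0 : b ≠ 0 := by
          rintro rfl
          simp at h
        rw [P.ord_mul (M.quad.aeval_ne_zero hb0) M.u_ne_zero, (P.ord_aeval_of_neg hP hb0).2,
          M.ord_u_of_neg hP]
        rw [mem_degreeLT, ← natDegree_lt_iff_degree_lt hb0] at hb
        have : (b.natDegree : ℤ) + 1 ≤ m := by exact_mod_cast hb
        push_cast
        nlinarith
    · rw [M.poles_of_nonneg hP, mul_zero, neg_zero]
      refine P.le_ord_add hne (fun _ => M.ord_aeval_nonneg hP a) fun h => ?_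
      rw [P.ord_mul (left_ne_zero_of_mul h) M.u_ne_zero]
      exact add_nonneg (M.ord_aeval_nonneg hP b) (M.ord_u_nonneg hP)

/-- Riemann's inequality in genus two: a divisor of degree at least two has a section. -/
theorem exists_neg_le_ord (M : SexticModel k K) (D : CurveDivisor k K) (hD : 2 ≤ CurveDivisor.deg k K D) :
    ∃ f : K, f ≠ 0 ∧ ∀ P : CurvePoint k K, -D P ≤ P.ord f := by
  obtain ⟨p, hp, hle⟩ := M.exists_le_ord_aeval D
  obtain ⟨Z, hZ, hZ0⟩ := M.exists_divisor_aeval hp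
  -- `m` is a crude upper bound for all coefficients of `D - Z`, which are at most 0 where `t` is
  -- finite; hence `D - Z ≤ (m + 2) • poles`.
  set m : ℕ := ∑ P ∈ (D - Z).support, ((D - Z) P).natAbs with hm
  have hmP : ∀ P, (D - Z) P ≤ m := fun P => by
    by_cases hP : P ∈ (D - Z).support
    · refine Int.le_natAbs.trans ?_
      exact_mod_cast Finset.single_le_sum (f := fun P => ((D - Z) P).natAbs)
        (fun _ _ => Nat.zero_le _) hP
    · rw [Finsupp.notMem_support_iff.1 hP]
      exact Int.natCast_nonneg _
  obtain ⟨V, hVfin, hVrank, hVle⟩ := M.exists_submodule_finrank m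
  set A := (m + 2) • M.poles with hA
  have hE0 : ∀ P, 0 ≤ (A - (D - Z)) P := fun P => by
    have h1 := hmP P
    have hAP : A P = (m + 2) * M.poles P := by
      rw [hA, Finsupp.smul_apply, nsmul_eq_mul]
      push_cast
      ring
    rw [Finsupp.sub_apply, hAP]
    rcases lt_or_ge (P.ord M.t) 0 with hP | hP
    · rw [M.poles_of_neg hP]
      nlinarith [Int.natCast_nonneg m]
    · rw [M.poles_of_nonneg hP, Finsupp.sub_apply, hZ]
      have := hle P hP
      linarith
  set E : CurvePoint k K →₀ ℕ := (A - (D - Z)).mapRange Int.toNat rfl with hE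
  have hEe : E.mapRange (fun n : ℕ => (n : ℤ)) rfl = A - (D - Z) := by
    ext P
    simp only [hE, Finsupp.mapRange_apply]
    exact Int.toNat_of_nonneg (hE0 P)
  -- `V` has dimension `2m + 3` and removing `E` costs at most `deg E = 2(m + 2) - deg D`, so a
  -- space of dimension at least `deg D - 1 ≥ 1` remains.
  have h1 := CurveDivisor.finrank_le_inf_sub M.degree_pos V A hVle E
  rw [hEe, hVrank, sub_sub_cancel, map_sub, map_sub, hZ0, hA, map_nsmul, M.deg_poles,
    nsmul_eq_mul] at h1
  have hpos : 0 < Module.finrank k ↥(V ⊓ CurveDivisor.riemannRochSpace (D - Z)) := by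
    push_cast at h1
    have : (0 : ℤ) < Module.finrank k ↥(V ⊓ CurveDivisor.riemannRochSpace (D - Z)) := by linarith
    exact_mod_cast this
  have := Module.nontrivial_of_finrank_pos hpos
  obtain ⟨⟨h, hhV, hhL⟩, hh0⟩ := exists_ne (0 : ↥(V ⊓ CurveDivisor.riemannRochSpace (D - Z)))
  have hh : h ≠ 0 := fun h0 => hh0 (Subtype.ext h0)
  have hp' := M.quad.aeval_ne_zero hp
  refine ⟨h / aeval M.t p, div_ne_zero hh hp', fun P => ?_⟩
  have h2 := hhL hh P
  rw [Finsupp.sub_apply, hZ] at h2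
  rw [P.ord_div hh hp']
  linarith

/-- If `deg D ≥ 1`, then `4D - poles` has degree at least `4 - 2 = 2` and so a section `g`. The
function `g f⁴` has no poles and vanishes at the poles of `t`: a nonzero constant with a zero. -/
theorem deg_nonpos_of_isDivisorOf (M : SexticModel k K) {D : CurveDivisor k K} {f : K} (h : D.IsDivisorOf f) :
    CurveDivisor.deg k K D ≤ 0 := by
  by_contra! hpos
  obtain ⟨g, hg, hgD⟩ := M.exists_neg_le_ord (4 • D - M.poles) (by
    rw [map_sub, map_nsmul, M.deg_poles, nsmul_eq_mul]
    push_cast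
    linarith)
  have hne : g * f ^ 4 ≠ 0 := mul_ne_zero hg (pow_ne_zero _ h.1)
  have hord : ∀ P : CurvePoint k K, M.poles P ≤ P.ord (g * f ^ 4) := fun P => by
    have h1 := hgD P
    rw [P.ord_mul hg (pow_ne_zero _ h.1), P.ord_pow, ← h.2 P]
    simp only [Finsupp.sub_apply, Finsupp.smul_apply, nsmul_eq_mul] at h1
    linarith
  obtain ⟨c, -, hc⟩ := M.exists_eq_algebraMap hne fun P => (M.poles_nonneg P).trans (hord P)
  obtain ⟨P, hP⟩ := M.exists_ord_t_neg
  have h1 := hord P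
  rw [hc, P.ord_algebraMap, M.poles_of_neg hP] at h1
  linarith

/-- Principal divisors have degree zero. -/
theorem deg_eq_zero_of_isDivisorOf (M : SexticModel k K) {D : CurveDivisor k K} {f : K} (h : D.IsDivisorOf f) :
    CurveDivisor.deg k K D = 0 := by
  refine le_antisymm (M.deg_nonpos_of_isDivisorOf h) ?_
  have h' : (-D).IsDivisorOf f⁻¹ := ⟨inv_ne_zero h.1, fun P => by
    rw [Finsupp.neg_apply, h.2, P.ord_inv]⟩
  have := M.deg_nonpos_of_isDivisorOf h'
  rw [map_neg] at this
  linarith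

end SexticModel

/-! ### Minimal polynomials and 3-torsion classes -/

namespace SexticModel

variable {k K : Type*} [Field k] [Field K] [Algebra k K] (M : SexticModel k K)

/-- A polynomial all of whose orders at the points of the curve are divisible by `3` is a constant
times a cube. -/
theorem exists_eq_C_mul_cube {p : k[X]} (hp : p ≠ 0)
    (h : ∀ P : CurvePoint k K, 0 ≤ P.ord M.t → 3 ∣ P.ord (aeval M.t p)) :
    ∃ (α : k) (x : k[X]), α ≠ 0 ∧ p = C α * x ^ 3 := by
  induction hn : p.natDegree using Nat.strong_induction_on generalizing p with
  | _ n ih =>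
    by_cases hu : IsUnit p
    · obtain ⟨c, hc, rfl⟩ := Polynomial.isUnit_iff.1 hu
      exact ⟨c, 1, hc.ne_zero, by simp⟩
    obtain ⟨π, hπ, hπp⟩ := WfDvdMonoid.exists_irreducible_factor hu hp
    obtain ⟨m, q, hq, rfl⟩ : ∃ m q, ¬ π ∣ q ∧ p = π ^ m * q := by
      obtain ⟨q, h1, h2⟩ :=
        (FiniteMultiplicity.of_not_isUnit hπ.not_isUnit hp).exists_eq_pow_mul_and_not_dvd
      exact ⟨_, q, h2, h1⟩
    have hq0 : q ≠ 0 := right_ne_zero_of_mul hp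
    have hm : m ≠ 0 := by
      rintro rfl
      rw [pow_zero, one_mul] at hπp
      exact hq hπp
    have hord : ∀ P : CurvePoint k K, P.ord (aeval M.t (π ^ m * q)) =
        m * P.ord (aeval M.t π) + P.ord (aeval M.t q) := fun P => by
      rw [M.ord_aeval_mul P (pow_ne_zero _ hπ.ne_zero) hq0, map_pow, P.ord_pow]
    -- At a point over `π` the order of `p` is `m e` with `e` equal to 1 or 2, so 3 divides `m`.
    have h3 : 3 ∣ m := by
      obtain ⟨P, hP, h1, h2⟩ := M.exists_point_over hπ
      have hqP : P.ord (aeval M.t q) = 0 := by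
        by_contra hne
        exact hq (M.dvd_of_ord_pos hπ h1 ((M.ord_aeval_nonneg hP q).lt_of_ne' hne))
      have h3 := h P hP
      rw [hord, hqP, add_zero] at h3
      rcases (by omega : P.ord (aeval M.t π) = 1 ∨ P.ord (aeval M.t π) = 2) with he | he <;>
        rw [he] at h3 <;> omega
    obtain ⟨j, rfl⟩ := h3
    have hdeg : q.natDegree < n := by
      rw [← hn, natDegree_mul (pow_ne_zero _ hπ.ne_zero) hq0, natDegree_pow]
      have := Nat.mul_pos (Nat.pos_of_ne_zero hm) hπ.natDegree_pos
      omega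
    obtain ⟨α, x, hα, hx⟩ := ih _ hdeg hq0 (fun P hP => by
      have h1 := h P hP
      rw [hord] at h1
      push_cast at h1
      rw [mul_assoc] at h1
      exact (dvd_add_right (dvd_mul_right _ _)).1 h1) rfl
    refine ⟨α, π ^ j * x, hα, ?_⟩
    rw [hx]
    ring

/-- The function `y(t) - u`. -/
def fn (y : k[X]) : K := aeval M.t y - M.u

/-- `y` has degree at most `3` and `y² - S` is a nonzero constant times a cube. -/
def IsMinimal (y : k[X]) : Prop :=
  y.natDegree ≤ 3 ∧ ∃ (α : k) (x : k[X]), α ≠ 0 ∧ y ^ 2 - M.S = C α * x ^ 3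

theorem eq_of_eq {a b a' b' : k[X]}
    (h : aeval M.t a + aeval M.t b * M.u = aeval M.t a' + aeval M.t b' * M.u) :
    a = a' ∧ b = b' := by
  have := M.quad.indep (a - a') (b - b') (by
    rw [map_sub, map_sub]
    linear_combination h)
  exact ⟨sub_eq_zero.1 this.1, sub_eq_zero.1 this.2⟩

theorem fn_ne_zero (y : k[X]) : M.fn y ≠ 0 := by
  intro h
  have := (M.quad.indep y (-1) (by
    rw [map_neg, map_one, ← h, fn]
    ring)).2
  simp at this

theorem map_fn (y : k[X]) : M.σ (M.fn y) = aeval M.t y + M.u := by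
  rw [fn, map_sub, M.map_aeval, M.map_u, sub_neg_eq_add]

theorem map_fn_ne_zero (y : k[X]) : M.σ (M.fn y) ≠ 0 :=
  (map_ne_zero M.σ).2 (M.fn_ne_zero y)

theorem fn_mul_map_fn (y : k[X]) : M.fn y * M.σ (M.fn y) = aeval M.t (y ^ 2 - M.S) := by
  rw [map_fn, fn, map_sub, map_pow, ← M.sq]
  ring

theorem sq_sub_ne_zero (y : k[X]) : y ^ 2 - M.S ≠ 0 := by
  intro h
  have := M.fn_mul_map_fn y
  rw [h, map_zero] at this
  exact mul_ne_zero (M.fn_ne_zero y) (M.map_fn_ne_zero y) this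

theorem ne_zero_of_sq_sub_eq {y x : k[X]} {α : k} (h : y ^ 2 - M.S = C α * x ^ 3) : x ≠ 0 := by
  rintro rfl
  exact M.sq_sub_ne_zero y (by simpa using h)

theorem ord_fn_add_ord_map_fn {y x : k[X]} {α : k} (hα : α ≠ 0) (h : y ^ 2 - M.S = C α * x ^ 3)
    (P : CurvePoint k K) :
    P.ord (M.fn y) + P.ord (M.σ (M.fn y)) = 3 * P.ord (aeval M.t x) := by
  rw [← P.ord_mul (M.fn_ne_zero y) (M.map_fn_ne_zero y), fn_mul_map_fn, h,
    M.ord_aeval_mul P (by simpa using hα) (pow_ne_zero _ (M.ne_zero_of_sq_sub_eq h)), aeval_C,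
    P.ord_algebraMap, map_pow, P.ord_pow]
  push_cast
  ring

theorem ord_fn_nonneg {P : CurvePoint k K} (hP : 0 ≤ P.ord M.t) (y : k[X]) :
    0 ≤ P.ord (M.fn y) :=
  P.le_ord_sub (M.fn_ne_zero y) (fun _ => M.ord_aeval_nonneg hP y) fun _ => M.ord_u_nonneg hP

theorem le_ord_fn_of_neg {P : CurvePoint k K} (hP : P.ord M.t < 0) {y : k[X]}
    (hy : y.natDegree ≤ 3) : 3 * P.ord M.t ≤ P.ord (M.fn y) := by
  refine P.le_ord_sub (M.fn_ne_zero y) (fun h => ?_) fun _ => (M.ord_u_of_neg hP).ge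
  have hy0 : y ≠ 0 := by
    rintro rfl
    simp at h
  rw [(P.ord_aeval_of_neg hP hy0).2]
  have : (y.natDegree : ℤ) ≤ 3 := by exact_mod_cast hy
  nlinarith

theorem ord_map_fn_nonneg {P : CurvePoint k K} (hP : 0 ≤ P.ord M.t) (y : k[X]) :
    0 ≤ P.ord (M.σ (M.fn y)) := by
  rw [← P.ord_comap]
  exact M.ord_fn_nonneg (by rwa [P.ord_comap, M.map_t]) y

theorem le_ord_map_fn_of_neg {P : CurvePoint k K} (hP : P.ord M.t < 0) {y : k[X]}
    (hy : y.natDegree ≤ 3) : 3 * P.ord M.t ≤ P.ord (M.σ (M.fn y)) := by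
  have h := M.le_ord_fn_of_neg (P := P.comap M.σ) (y := y) (by rwa [P.ord_comap, M.map_t]) hy
  rwa [P.ord_comap, P.ord_comap, M.map_t] at h

theorem map_fn_sub_fn (y : k[X]) : M.σ (M.fn y) - M.fn y = 2 * M.u := by
  rw [map_fn, fn]
  ring

/-- A common irreducible factor of `y` and `S` divides `x`, so its square divides `y² - αx³ = S`,
which is squarefree. -/
theorem isCoprime_of_sq_sub_eq {y x : k[X]} {α : k} (h : y ^ 2 - M.S = C α * x ^ 3)
    (hα : α ≠ 0) : IsCoprime y M.S := by
  refine isCoprime_of_irreducible_dvd (fun h0 => M.S_ne_zero h0.2) fun π hπ hy hS => ?_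
  have h1 : π ∣ C α * x ^ 3 := h ▸ dvd_sub (dvd_pow hy two_ne_zero) hS
  have hx : π ∣ x := by
    have hC : IsUnit (C α : k[X]) := isUnit_C.2 hα.isUnit
    exact hπ.prime.dvd_of_dvd_pow ((hC.dvd_mul_left).1 h1)
  have h2 : π ^ 2 ∣ C α * x ^ 3 :=
    ((pow_dvd_pow_of_dvd hx 2).trans (pow_dvd_pow x (by norm_num))).mul_left _
  have h3 : π ^ 2 ∣ M.S := by
    have := dvd_sub (pow_dvd_pow_of_dvd hy 2) h2
    rwa [← h, sub_sub_cancel] at this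
  exact hπ.not_isUnit (M.squarefree π (by rwa [← _root_.sq]))

variable {M} in
-- The orders of `y - u` and `y + u` sum to a multiple of 3, so it suffices that one of them is a
-- multiple of 3. The difference `2u` of the two functions provides it.
theorem IsMinimal.three_dvd_ord {y : k[X]} (hy : M.IsMinimal y) (P : CurvePoint k K) :
    3 ∣ P.ord (M.fn y) := by
  obtain ⟨hdeg, α, x, hα, h⟩ := hy
  have hsum := M.ord_fn_add_ord_map_fn hα h P
  have h2 := M.two_ne_zero_K
  have h2u : M.σ (M.fn y) - M.fn y ≠ 0 := by
    rw [map_fn_sub_fn]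
    exact mul_ne_zero h2 M.u_ne_zero
  have hord2u : P.ord (M.σ (M.fn y) - M.fn y) = P.ord M.u := by
    rw [map_fn_sub_fn, P.ord_mul h2 M.u_ne_zero, P.ord_two, zero_add]
  rcases lt_or_ge (P.ord M.t) 0 with hP | hP
  · have h1 := M.le_ord_fn_of_neg hP hdeg
    have h1' := M.le_ord_map_fn_of_neg hP hdeg
    -- Both orders are at least `3 ord t`, and they cannot both exceed it, since `2u` has exactly
    -- this order.
    have h3 : P.ord (M.fn y) = 3 * P.ord M.t ∨ P.ord (M.σ (M.fn y)) = 3 * P.ord M.t := by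
      by_contra! hne
      have := P.le_ord_sub (n := 3 * P.ord M.t + 1) h2u (fun _ => by omega) (fun _ => by omega)
      rw [hord2u, M.ord_u_of_neg hP] at this
      omega
    omega
  · have h1 := M.ord_fn_nonneg hP y
    have h1' := M.ord_map_fn_nonneg hP y
    -- A common zero of `y - u` and `y + u` would be one of `y` and of `u`, against the coprimality
    -- of `y` and `S`.
    have h3 : P.ord (M.fn y) = 0 ∨ P.ord (M.σ (M.fn y)) = 0 := by
      by_contra! hne
      have hu := P.le_ord_sub (n := 1) h2u (fun _ => by omega) (fun _ => by omega)
      rw [hord2u] at hu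
      refine M.not_isCoprime_of_ord_pos hP (fun hy0 => ?_) ?_ (M.isCoprime_of_sq_sub_eq h hα)
      · have hs : M.σ (M.fn y) + M.fn y = 2 * aeval M.t y := by
          rw [map_fn, fn]
          ring
        have h2y := mul_ne_zero h2 hy0
        have := P.le_ord_add (n := 1) (hs ▸ h2y) (fun _ => by omega) (fun _ => by omega)
        rw [hs, P.ord_mul h2 hy0, P.ord_two, zero_add] at this
        omega
      · rw [← M.sq, P.ord_pow]
        push_cast
        omega
    omega

variable {M} in
theorem IsMinimal.exists_divisor {y : k[X]} (hy : M.IsMinimal y) :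
    ∃ D : CurveDivisor k K, CurveDivisor.deg k K D = 0 ∧ (3 • D).IsDivisorOf (M.fn y) := by
  classical
  obtain ⟨hdeg, α, x, hα, h⟩ := id hy
  obtain ⟨Z, hZ, -⟩ := M.exists_divisor_aeval (M.ne_zero_of_sq_sub_eq h)
  -- Away from the zeros of `x` and the poles of `t`, the orders of `y ± u` are nonnegative with sum
  -- 0, so the support is finite.
  let D : CurveDivisor k K := Finsupp.onFinset (Z.support ∪ M.poles.support)
    (fun P => P.ord (M.fn y) / 3) fun P hP => by
      rw [Finset.mem_union, Finsupp.mem_support_iff, Finsupp.mem_support_iff, hZ]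
      by_contra! hne
      have hP0 : 0 ≤ P.ord M.t := by
        by_contra! hlt
        rw [M.poles_of_neg hlt] at hne
        omega
      have h1 := M.ord_fn_nonneg hP0 y
      have h2 := M.ord_map_fn_nonneg hP0 y
      have h3 := M.ord_fn_add_ord_map_fn hα h P
      rw [hne.1] at h3
      apply hP
      rw [show P.ord (M.fn y) = 0 by omega, Int.zero_ediv]
  have hD : (3 • D).IsDivisorOf (M.fn y) := by
    refine ⟨M.fn_ne_zero y, fun P => ?_⟩
    rw [Finsupp.smul_apply, nsmul_eq_mul]
    exact Int.mul_ediv_cancel' (hy.three_dvd_ord P)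
  refine ⟨D, ?_, hD⟩
  have := M.deg_eq_zero_of_isDivisorOf hD
  rw [map_nsmul, nsmul_eq_mul] at this
  simpa using this

theorem three_mul_apply {D : CurveDivisor k K} {f : K} (h : (3 • D).IsDivisorOf f)
    (P : CurvePoint k K) : 3 * D P = P.ord f := by
  have := h.2 P
  rwa [Finsupp.smul_apply, nsmul_eq_mul] at this

variable {M} in
-- If `D = div g`, the poles of `g` are at most those of `t`, so `g` lies in `k[t]`; then `y - u` is
-- a constant times `g³` and would have no `u` term.
theorem IsMinimal.notMem_principal {y : k[X]} (hy : M.IsMinimal y) {D : CurveDivisor k K}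
    (hD : (3 • D).IsDivisorOf (M.fn y)) : D ∉ CurveDivisor.principal k K := by
  rintro ⟨g, hg, hDg⟩
  have h3 : ∀ P : CurvePoint k K, 3 * P.ord g = P.ord (M.fn y) := fun P => by
    rw [← hDg P, three_mul_apply hD]
  obtain ⟨a, b, hge, -, hb⟩ := M.exists_eq_of_neg_poles_le (f := g) (n := 1) fun P => by
    have h := h3 P
    push_cast
    rcases lt_or_ge (P.ord M.t) 0 with hP | hP
    · have := M.le_ord_fn_of_neg hP hy.1
      rw [M.poles_of_neg hP]
      omega
    · have := M.ord_fn_nonneg hP y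
      rw [M.poles_of_nonneg hP]
      omega
  have hb0 : b = 0 := by
    by_contra h0
    have := hb h0
    omega
  rw [hb0, map_zero, zero_mul, add_zero] at hge
  have hg3 : g ^ 3 ≠ 0 := pow_ne_zero _ hg
  obtain ⟨c, -, hc⟩ := M.exists_eq_algebraMap (div_ne_zero (M.fn_ne_zero y) hg3) fun P => by
    rw [P.ord_div (M.fn_ne_zero y) hg3, P.ord_pow, ← h3 P]
    push_cast
    omega
  rw [div_eq_iff hg3, hge, fn] at hc
  have := (M.eq_of_eq (a := y) (b := -1) (a' := C c * a ^ 3) (b' := 0) (by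
    simp only [map_mul, map_pow, map_neg, map_one, map_zero, aeval_C]
    linear_combination hc)).2
  simp at this

/-- Every nontrivial `3`-torsion class is represented by a minimal polynomial. -/
theorem exists_isMinimal {D₀ : CurveDivisor k K} (hdeg : CurveDivisor.deg k K D₀ = 0)
    (hD₀ : D₀ ∉ CurveDivisor.principal k K) (h3 : 3 • D₀ ∈ CurveDivisor.principal k K) :
    ∃ y, M.IsMinimal y ∧ ∃ D : CurveDivisor k K, CurveDivisor.deg k K D = 0 ∧
      (3 • D).IsDivisorOf (M.fn y) ∧ D - D₀ ∈ CurveDivisor.principal k K := by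
  obtain ⟨f, hf⟩ := h3
  -- Degree exactly 2 is the threshold of Riemann's inequality, and cubing the section gives poles
  -- at most three times those of `t`, the bound at which `u` first appears.
  obtain ⟨g, hg, hgD⟩ := M.exists_neg_le_ord (D₀ + M.poles) (by
    rw [map_add, hdeg, M.deg_poles, zero_add])
  have hg3 : g ^ 3 ≠ 0 := pow_ne_zero _ hg
  have hord : ∀ P : CurvePoint k K, P.ord (f * g ^ 3) = 3 * (D₀ P + P.ord g) := fun P => by
    rw [P.ord_mul hf.1 hg3, P.ord_pow, ← three_mul_apply hf P]
    push_cast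
    ring
  have hne : f * g ^ 3 ≠ 0 := mul_ne_zero hf.1 hg3
  obtain ⟨a, b, hab, ha, hb⟩ := M.exists_eq_of_neg_poles_le (f := f * g ^ 3) (n := 3) fun P => by
    have := hgD P
    rw [hord]
    rw [Finsupp.add_apply] at this
    push_cast
    linarith
  rcases eq_or_ne b 0 with rfl | hb0
  · rw [map_zero, zero_mul, add_zero] at hab
    have ha0 : a ≠ 0 := by
      rintro rfl
      rw [map_zero] at hab
      exact hne hab
    obtain ⟨α, x, hα, hx⟩ := M.exists_eq_C_mul_cube ha0 fun P _ => by
      rw [← hab, hord]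
      exact dvd_mul_right _ _
    have hx0 : x ≠ 0 := by
      rintro rfl
      simp [ha0] at hx
    have hx' := M.quad.aeval_ne_zero hx0
    -- Without a `u` term, `f g³ = αx³`, so `D₀` is the divisor of `x / g`.
    refine absurd ⟨aeval M.t x / g, div_ne_zero hx' hg, fun P => ?_⟩ hD₀
    have h1 := hord P
    rw [hab, hx, M.ord_aeval_mul P (by simpa using hα) (pow_ne_zero _ hx0), aeval_C,
      P.ord_algebraMap, map_pow, P.ord_pow] at h1
    rw [P.ord_div hx' hg]
    push_cast at h1
    linarith
  · have hbdeg := hb hb0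
    obtain ⟨β, rfl⟩ : ∃ β, b = C β := ⟨_, eq_C_of_natDegree_le_zero (by omega)⟩
    have hβ : β ≠ 0 := by simpa using hb0
    have hβ' : algebraMap k K β ≠ 0 := by simpa using hβ
    -- Scaling makes the coefficient of `u` equal to `-1`.
    have hfn : f * g ^ 3 = algebraMap k K (-β) * M.fn (C (-β⁻¹) * a) := by
      rw [hab, fn, map_mul, aeval_C, aeval_C, map_neg, map_neg, map_inv₀]
      field_simp
      ring
    set y := C (-β⁻¹) * a with hy
    have hordy : ∀ P : CurvePoint k K, P.ord (M.fn y) = 3 * (D₀ P + P.ord g) := fun P => by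
      rw [← hord, hfn, P.ord_mul (by simpa using hβ) (M.fn_ne_zero y), P.ord_algebraMap, zero_add]
    have hmin : M.IsMinimal y := by
      refine ⟨(natDegree_C_mul_le _ _).trans ha, ?_⟩
      refine M.exists_eq_C_mul_cube (M.sq_sub_ne_zero y) fun P _ => ?_
      -- The order of the conjugate at `P` is that of `y - u` at the conjugate point, hence also a
      -- multiple of 3.
      rw [← fn_mul_map_fn, P.ord_mul (M.fn_ne_zero y) (M.map_fn_ne_zero y), ← P.ord_comap M.σ,
        hordy, hordy]
      exact dvd_add (dvd_mul_right _ _) (dvd_mul_right _ _)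
    obtain ⟨D, hD, hDy⟩ := hmin.exists_divisor
    refine ⟨y, hmin, D, hD, hDy, g, hg, fun P => ?_⟩
    have h1 := three_mul_apply hDy P
    rw [hordy] at h1
    rw [Finsupp.sub_apply]
    omega

/-- The minimal polynomial of a `3`-torsion class is unique. -/
theorem IsMinimal.unique {M : SexticModel k K} {y₁ y₂ : k[X]} (hy₁ : M.IsMinimal y₁)
    (hy₂ : M.IsMinimal y₂) {D₁ D₂ : CurveDivisor k K} (hD₁ : (3 • D₁).IsDivisorOf (M.fn y₁))
    (hD₂ : (3 • D₂).IsDivisorOf (M.fn y₂)) (h : D₁ - D₂ ∈ CurveDivisor.principal k K) :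
    y₁ = y₂ := by
  obtain ⟨g, hg, hgD⟩ := h
  have hordg : ∀ P : CurvePoint k K, P.ord (M.fn y₁) = 3 * P.ord g + P.ord (M.fn y₂) := fun P => by
    have := hgD P
    rw [Finsupp.sub_apply] at this
    rw [← three_mul_apply hD₁, ← three_mul_apply hD₂, ← this]
    ring
  obtain ⟨hdeg₂, α, x, hα, hx⟩ := hy₂
  have hx0 := M.ne_zero_of_sq_sub_eq hx
  have hx' := M.quad.aeval_ne_zero hx0
  have hg3 : g ^ 3 ≠ 0 := pow_ne_zero _ hg
  have hg3y := mul_ne_zero hg3 (M.fn_ne_zero y₂)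
  obtain ⟨c, -, hc⟩ := M.exists_eq_algebraMap (div_ne_zero (M.fn_ne_zero y₁) hg3y) fun P => by
    rw [P.ord_div (M.fn_ne_zero y₁) hg3y, P.ord_mul hg3 (M.fn_ne_zero y₂), P.ord_pow, hordg]
    push_cast
    omega
  rw [div_eq_iff hg3y] at hc
  -- Three times the order of `gx` is the order of `(y₁ - u)(y₂ + u)`, which has no pole where `t`
  -- is finite and order at least `6 ord t` at infinity. With `n = 2` no `u` term fits.
  obtain ⟨a, b, hab, -, hb⟩ := M.exists_eq_of_neg_poles_le (f := g * aeval M.t x) (n := 2)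
    fun P => by
      have h1 := hordg P
      have h2 := M.ord_fn_add_ord_map_fn hα hx P
      rw [P.ord_mul hg hx']
      push_cast
      rcases lt_or_ge (P.ord M.t) 0 with hP | hP
      · have := M.le_ord_fn_of_neg hP hy₁.1
        have := M.le_ord_map_fn_of_neg hP hdeg₂
        rw [M.poles_of_neg hP]
        omega
      · have := M.ord_fn_nonneg hP y₁
        have := M.ord_map_fn_nonneg hP y₂
        rw [M.poles_of_nonneg hP]
        omega
  have hb0 : b = 0 := by
    by_contra h0
    have := hb h0
    omega
  rw [hb0, map_zero, zero_mul, add_zero] at hab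
  have hkey : aeval M.t x ^ 3 * M.fn y₁ = algebraMap k K c * aeval M.t a ^ 3 * M.fn y₂ := by
    rw [hc, ← hab]
    ring
  obtain ⟨h1, h2⟩ := M.eq_of_eq (a := x ^ 3 * y₁) (b := -x ^ 3) (a' := C c * a ^ 3 * y₂)
    (b' := -(C c * a ^ 3)) (by
      simp only [map_mul, map_pow, map_neg, aeval_C]
      rw [fn, fn] at hkey
      linear_combination hkey)
  rw [← neg_inj.1 h2] at h1
  exact mul_left_cancel₀ (pow_ne_zero 3 hx0) h1

end SexticModel

/-! ### The function field of `u² = S(t)` as a sextic model -/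

namespace SeparableSextic

variable {k : Type*} [Field k] (S : SeparableSextic k)

theorem monic_equation : (X ^ 2 - C S.poly : k[X][X]).Monic := monic_X_pow_sub_C _ two_ne_zero

theorem natDegree_equation : (X ^ 2 - C S.poly : k[X][X]).natDegree = 2 := natDegree_X_pow_sub_C

theorem root_sq : (AdjoinRoot.root (X ^ 2 - C S.poly : k[X][X])) ^ 2 =
    AdjoinRoot.of (X ^ 2 - C S.poly) S.poly := by
  have := AdjoinRoot.eval₂_root (X ^ 2 - C S.poly : k[X][X])
  rwa [eval₂_sub, eval₂_pow, eval₂_X, eval₂_C, sub_eq_zero] at this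

theorem exists_eq_of_add_of_mul_root (r : S.CoordinateRing) : ∃ a b : k[X],
    r = AdjoinRoot.of _ a + AdjoinRoot.of _ b * AdjoinRoot.root _ := by
  obtain ⟨p, rfl⟩ := AdjoinRoot.mk_surjective r
  have hd := natDegree_modByMonic_lt p S.monic_equation (by
    intro h
    have := S.natDegree_equation
    rw [h, natDegree_one] at this
    omega)
  rw [natDegree_equation] at hd
  obtain ⟨b, a, h⟩ := exists_eq_X_add_C_of_natDegree_le_one (Nat.le_of_lt_succ hd)
  refine ⟨a, b, ?_⟩
  rw [← AdjoinRoot.mk_leftInverse S.monic_equation (AdjoinRoot.mk _ p)]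
  rw [AdjoinRoot.modByMonicHom_mk, h]
  simp only [map_add, map_mul, AdjoinRoot.mk_C, AdjoinRoot.mk_X]
  ring

theorem of_add_of_mul_root_eq_zero {a b : k[X]} (h : (AdjoinRoot.of _ a +
    AdjoinRoot.of _ b * AdjoinRoot.root _ : S.CoordinateRing) = 0) : a = 0 ∧ b = 0 := by
  have h1 : AdjoinRoot.mk (X ^ 2 - C S.poly) (C b * X + C a) = 0 := by
    simp only [map_add, map_mul, AdjoinRoot.mk_C, AdjoinRoot.mk_X]
    rw [add_comm]
    exact h
  rw [AdjoinRoot.mk_eq_zero] at h1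
  have h2 : C b * X + C a = 0 := by
    by_contra hne
    have := natDegree_le_of_dvd h1 hne
    rw [natDegree_equation] at this
    have := natDegree_linear_le (a := b) (b := a)
    omega
  have h3 := congrArg (fun p => coeff p 0) h2
  have h4 := congrArg (fun p => coeff p 1) h2
  exact ⟨by simpa using h3, by simpa using h4⟩

/-- The hyperelliptic involution on the coordinate ring, as a homomorphism. -/
def involutionHom : S.CoordinateRing →ₐ[k] S.CoordinateRing :=
  AdjoinRoot.liftAlgHom _ (IsScalarTower.toAlgHom k k[X] S.CoordinateRing) (-AdjoinRoot.root _) (by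
    rw [eval₂_sub, eval₂_pow, eval₂_X, eval₂_C, neg_sq, root_sq]
    exact sub_self _)

theorem involutionHom_of (a : k[X]) :
    S.involutionHom (AdjoinRoot.of _ a) = AdjoinRoot.of _ a :=
  AdjoinRoot.liftAlgHom_of ..

theorem involutionHom_root :
    S.involutionHom (AdjoinRoot.root _) = -AdjoinRoot.root _ :=
  AdjoinRoot.liftAlgHom_root ..

theorem involutionHom_involutionHom (r : S.CoordinateRing) :
    S.involutionHom (S.involutionHom r) = r := by
  obtain ⟨a, b, rfl⟩ := S.exists_eq_of_add_of_mul_root r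
  simp only [map_add, map_mul, map_neg, involutionHom_of, involutionHom_root, neg_neg]

/-- The hyperelliptic involution on the coordinate ring. -/
def involution : S.CoordinateRing ≃ₐ[k] S.CoordinateRing :=
  AlgEquiv.ofAlgHom S.involutionHom S.involutionHom
    (AlgHom.ext S.involutionHom_involutionHom) (AlgHom.ext S.involutionHom_involutionHom)

/-- The hyperelliptic involution on the function field. -/
def fieldInvolution : S.FunctionField ≃ₐ[k] S.FunctionField :=
  IsFractionRing.fieldEquivOfAlgEquiv k S.FunctionField S.FunctionField S.involution

theorem ofPoly_eq_aeval (p : k[X]) : S.ofPoly p = aeval (S.ofPoly X) p := by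
  have h : ∀ p, S.ofPoly p = algebraMap k[X] S.FunctionField p := fun p =>
    (IsScalarTower.algebraMap_apply k[X] S.CoordinateRing S.FunctionField p).symm
  rw [h, h, CurvePoint.algebraMap_eq_aeval]

theorem eq_zero_of_ofPoly_add {a b : k[X]} (h : S.ofPoly a + S.ofPoly b * S.u = 0) :
    a = 0 ∧ b = 0 := by
  refine S.of_add_of_mul_root_eq_zero (IsFractionRing.injective S.CoordinateRing S.FunctionField ?_)
  rw [map_zero, map_add, map_mul]
  exact h

/-- Multiplying numerator and denominator by the conjugate of the denominator replaces the
denominator by its norm, a polynomial in `t`. -/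
theorem exists_ofPoly_eq (f : S.FunctionField) : ∃ a b c : k[X],
    S.ofPoly c ≠ 0 ∧ f * S.ofPoly c = S.ofPoly a + S.ofPoly b * S.u := by
  obtain ⟨r, s, hs, rfl⟩ := IsFractionRing.div_surjective (A := S.CoordinateRing) f
  have hs0 : s ≠ 0 := nonZeroDivisors.ne_zero hs
  obtain ⟨c₁, c₂, hc⟩ := S.exists_eq_of_add_of_mul_root s
  have hnorm : s * S.involution s =
      AdjoinRoot.of (X ^ 2 - C S.poly) (c₁ ^ 2 - c₂ ^ 2 * S.poly) := by
    change s * S.involutionHom s = _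
    rw [hc]
    simp only [map_add, map_mul, map_sub, map_pow, involutionHom_of, involutionHom_root, ← root_sq]
    ring
  obtain ⟨a, b, hab⟩ := S.exists_eq_of_add_of_mul_root (r * S.involution s)
  have hs' : algebraMap S.CoordinateRing S.FunctionField s ≠ 0 := by simpa using hs0
  refine ⟨a, b, c₁ ^ 2 - c₂ ^ 2 * S.poly, ?_, ?_⟩
  · rw [ofPoly, ← hnorm, map_mul]
    exact mul_ne_zero hs' (by simpa using hs0)
  · have h1 := congrArg (algebraMap S.CoordinateRing S.FunctionField) hab
    rw [map_add, map_mul, map_mul] at h1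
    rw [ofPoly, ← hnorm, map_mul]
    refine Eq.trans ?_ h1
    field_simp

/-- The function field of `u² = S(t)` as an instance of the abstract model. -/
def model (h2 : (2 : k) ≠ 0) : SexticModel k S.FunctionField where
  S := S.poly
  t := S.ofPoly X
  u := S.u
  σ := S.fieldInvolution
  two_ne := h2
  natDegree_eq := S.natDegree_eq
  squarefree := S.separable.squarefree
  sq := by
    rw [← ofPoly_eq_aeval, u, ← map_pow, root_sq, ofPoly]
  quad :=
    { exists_eq := fun f => by
        simp only [← ofPoly_eq_aeval]
        exact S.exists_ofPoly_eq f
      indep := fun a b h => by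
        simp only [← ofPoly_eq_aeval] at h
        exact S.eq_zero_of_ofPoly_add h
      exists_sq := ⟨S.poly, by rw [← ofPoly_eq_aeval, u, ← map_pow, root_sq, ofPoly]⟩ }
  map_t := by
    refine (IsFractionRing.fieldEquivOfAlgEquiv_algebraMap ..).trans ?_
    exact congrArg _ (S.involutionHom_of X)
  map_u := by
    refine (IsFractionRing.fieldEquivOfAlgEquiv_algebraMap ..).trans ?_
    rw [u, ← map_neg]
    exact congrArg _ S.involutionHom_root

theorem model_fn (h2 : (2 : k) ≠ 0) (y : k[X]) : (S.model h2).fn y = S.ofPoly y - S.u := by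
  rw [ofPoly_eq_aeval]
  rfl

theorem model_isMinimal (h2 : (2 : k) ≠ 0) {y : k[X]} :
    (S.model h2).IsMinimal y ↔ S.IsMinimal y := Iff.rfl

end SeparableSextic
end
theorem theorem1 {k : Type*} [Field k] (h2 : (2 : k) ≠ 0) (h3 : (3 : k) ≠ 0)
    (hρ : ∃ ρ : k, IsPrimitiveRoot ρ 3) (S : SeparableSextic k) :
    (∀ y : Polynomial k, S.IsMinimal y →
      ∃ D : CurveDivisor.degZero k S.FunctionField,
        (3 • (D : S.Divisor)).IsDivisorOf (S.ofPoly y - S.u) ∧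
        (D : S.Divisor) ∉ CurveDivisor.principal k S.FunctionField) ∧
    (∀ T : S.Jacobian, T ≠ 0 → 3 • T = 0 →
      ∃! y : Polynomial k, S.IsMinimal y ∧
        ∃ D : CurveDivisor.degZero k S.FunctionField,
          (3 • (D : S.Divisor)).IsDivisorOf (S.ofPoly y - S.u) ∧
          (QuotientAddGroup.mk D : S.Jacobian) = T) := by
  have hmin : ∀ {y}, S.IsMinimal y → (S.model h2).IsMinimal y := (S.model_isMinimal h2).2
  simp only [← S.model_fn h2]
  constructor
  · intro y hy
    obtain ⟨D, hD0, hD⟩ := (hmin hy).exists_divisor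
    exact ⟨⟨D, hD0⟩, hD, (hmin hy).notMem_principal hD⟩
  · intro T hT hT3
    obtain ⟨D₀, rfl⟩ := QuotientAddGroup.mk_surjective T
    rw [Ne, QuotientAddGroup.eq_zero_iff, AddSubgroup.mem_addSubgroupOf] at hT
    rw [← QuotientAddGroup.mk_nsmul, QuotientAddGroup.eq_zero_iff,
      AddSubgroup.mem_addSubgroupOf] at hT3
    obtain ⟨y, hy, D, hD0, hD, hDD⟩ := (S.model h2).exists_isMinimal D₀.2 hT hT3
    have heq : (QuotientAddGroup.mk (⟨D, hD0⟩ : CurveDivisor.degZero k S.FunctionField) :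
        S.Jacobian) = QuotientAddGroup.mk D₀ := by
      rw [eq_comm, QuotientAddGroup.eq, AddSubgroup.mem_addSubgroupOf]
      change -(D₀ : S.Divisor) + D ∈ _
      rwa [neg_add_eq_sub]
    refine ⟨y, ⟨hy, ⟨D, hD0⟩, hD, heq⟩, ?_⟩
    rintro y' ⟨hy', D', hD', hDT⟩
    refine (hmin hy').unique hy hD' hD ?_
    rw [← heq, eq_comm, QuotientAddGroup.eq, AddSubgroup.mem_addSubgroupOf] at hDT
    have h := neg_add_eq_sub D (D' : S.Divisor)
    rw [← h]
    exact hDT
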